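/- **Setting.** Let $0<T_1<T_2<\cdots$ be the points of a (non-homogeneous) Poisson process on $[0,\infty)$ with locally finite mean measure $\Lambda$ (with $T_k=\infty$ if there are fewer than $k$ points). Let $(D_k)_{k\ge1}$ be iid non-negative random variables with law $F_D$. Let $(L_k)_{k\ge 1}$ be iid additive processes of jump type, with generic element $L$: $L(u)=0$ for $u\le 0$, $L$ has independent increments and càdlàg paths, is stochastically continuous, and $$E[e^{ixL(u)}]=\exp\Big\{\int_{(0,u]\times\mathbb R}(e^{ixv}-1)\,\nu(dr,dv)\Big\},\qquad u\ge 0,\ x\in\mathbb R,$$ where $\nu$ is a measure on $(0,\infty)\times\mathbb R$ with $\nu((0,u]\times\{0\})=0$, $\nu(\{u\}\times\mathbb R)=0$ and $\int_{(0,u]\times\mathbb R}(|v|\wedge 1)\,\nu(dr,dv)<\infty$ for all $u$. Assume that $(T_k)$, $(D_k)$ and $(L_k)$ are mutually independent. Put $$M(t)=\sum_{j:\,T_j\le 1}L_j\big(t-(T_j+D_j)\big),\qquad M(t,t+s]=M(t+s)-M(t),$$ $$\widehat N(t)=\#\{k\ge 1: T_k\in[0,1],\ T_k+D_k\le t\},$$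 write $L(a,b]=L(b)-L(a)$, and let $\Lambda * F_D$ be the convolution of the restriction of $\Lambda$ to $[0,1]$ with $F_D$. For $i=1,2$ put $$J_i=\int_{[0,t]}E\big[L(t-u,t+s-u]^i\big]\,\frac{(\Lambda * F_D)(du)}{E[\widehat N(t)]},\qquad H_i=\int_{[0,1]}\int_{(t-v,\,t+s-v]}E\big[L(t+s-v-r)^i\big]\,F_D(dr)\,\Lambda(dv).$$ **Theorem.** Let $t\ge 1$, $s>0$ and $\ell\in\{0,1,2,\dots\}$ with $P(\widehat N(t)=\ell)>0$. (If $E[\widehat N(t)]=0$, then necessarily $\ell=0$, and the terms containing $\ell$ are read as $0$.) (i) If $E|L(u)|<\infty$ for all $u\ge 0$, then the integrals over $[0,t]$ in $J_1$ and over $\{(v,r):0\le v\le 1,\ t-v<r\le t+s-v\}$ in $H_1$ converge absolutely, $M(t,t+s]$ is integrable under $P(\,\cdot\mid\widehat N(t)=\ell)$, and $$E[M(t,t+s]\mid \widehat N(t)=\ell]=\ell J_1+H_1 .$$ (ii) If $E[L(u)^2]<\infty$ for all $u\ge 0$, then the integrals in $J_2$ and $H_2$ also converge absolutely, $M(t,t+s]$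 is square integrable under $P(\,\cdot\mid\widehat N(t)=\ell)$, and $$\mathrm{Var}\big(M(t,t+s]\mid \widehat N(t)=\ell\big)=\ell J_2-\ell J_1^2+H_2 .$$ -/

import Mathlib

open MeasureTheory ProbabilityTheory Filter Topology Set
open scoped ENNReal

noncomputable section

namespace DelayedCluster

variable {Ω : Type*} [MeasurableSpace Ω]

/-- The number of points of the sequence `T` which lie in `B`. The value `T k = ∞` means that there
is no `k`-th point. -/
def pointCount (T : ℕ → Ω → ℝ≥0∞) (B : Set ℝ) (ω : Ω) : ℕ∞ :=
  {k : ℕ | T k ω ≠ ∞ ∧ (T k ω).toReal ∈ B}.encard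

/-- `0 < T 0 < T 1 < ⋯` are the points of a (non-homogeneous) Poisson process with mean measure
`Λ`: the numbers of points in pairwise disjoint Borel sets of finite `Λ`-measure are independent
and Poisson distributed with parameters the `Λ`-measures of these sets. -/
structure IsPoissonArrivals (P : Measure Ω) (Λ : Measure ℝ) (T : ℕ → Ω → ℝ≥0∞) : Prop where
  measurable : ∀ k, Measurable (T k)
  pos : ∀ᵐ ω ∂P, 0 < T 0 ω
  increasing : ∀ᵐ ω ∂P, ∀ k, T k ω < T (k + 1) ω ∨ (T k ω = ∞ ∧ T (k + 1) ω = ∞)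
  count_law : ∀ (m : ℕ) (B : Fin m → Set ℝ), (∀ i, MeasurableSet (B i)) →
    (∀ i j, i ≠ j → Disjoint (B i) (B j)) → (∀ i, Λ (B i) ≠ ∞) → ∀ n : Fin m → ℕ,
      P {ω | ∀ i, pointCount T (B i) ω = n i} = ∏ i, poissonMeasure (Λ (B i)).toNNReal {n i}

/-- The conditions on the time-space jump intensity `ν`. Only the part of `ν` on `(0, ∞) × ℝ`
matters; a point of the plane is (time of the jump, size of the jump). -/
structure IsJumpIntensity (ν : Measure (ℝ × ℝ)) : Prop where
  no_zero_jump : ∀ u : ℝ, 0 ≤ u → ν (Ioc 0 u ×ˢ {0}) = 0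
  no_fixed_jump : ∀ u : ℝ, 0 < u → ν ({u} ×ˢ univ) = 0
  small_jumps : ∀ u : ℝ, 0 ≤ u →
    ∫⁻ z in Ioc 0 u ×ˢ (univ : Set ℝ), ENNReal.ofReal (min |z.2| 1) ∂ν < ∞

/-- `X` is an additive process of jump type with jump intensity `ν`, extended by `0` to negative
times: it has independent increments, is stochastically continuous, starts at `0`, has càdlàg paths,
and `E[exp(i x X(u))] = exp (∫_{(0,u] × ℝ} (exp(i x v) - 1) ν(dr, dv))`. -/
structure IsJumpAdditiveProcess (P : Measure Ω) (ν : Measure (ℝ × ℝ)) (X : ℝ → Ω → ℝ) : Prop where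
  measurable : ∀ u, Measurable (X u)
  eq_zero : ∀ᵐ ω ∂P, ∀ u ≤ 0, X u ω = 0
  indep_increments : HasIndepIncrements X P
  stoch_continuous : ∀ u, 0 ≤ u → TendstoInMeasure P X (𝓝 u) (X u)
  cadlag : ∀ᵐ ω ∂P, ∀ u, 0 ≤ u → ContinuousWithinAt (fun r => X r ω) (Ici u) u ∧
    ∃ l : ℝ, Tendsto (fun r => X r ω) (𝓝[<] u) (𝓝 l)
  charFun_eq : ∀ u, 0 ≤ u → ∀ x : ℝ, charFun (P.map (X u)) x =
    Complex.exp (∫ z in Ioc 0 u ×ˢ (univ : Set ℝ),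
      (Complex.exp ((x * z.2 : ℝ) * Complex.I) - 1) ∂ν)

open scoped Classical in
/-- `M(t) = ∑_{j : T_j ≤ 1} L_j(t - (T_j + D_j))`; almost surely the sum has finitely many
non-zero terms. -/
def totalAmount (T : ℕ → Ω → ℝ≥0∞) (D : ℕ → Ω → ℝ) (L : ℕ → ℝ → Ω → ℝ) (t : ℝ) (ω : Ω) : ℝ :=
  ∑' j : ℕ, if T j ω ≤ 1 then L j (t - ((T j ω).toReal + D j ω)) ω else 0

/-- `M(t, t+s] = M(t+s) - M(t)`. -/
def increment (T : ℕ → Ω → ℝ≥0∞) (D : ℕ → Ω → ℝ) (L : ℕ → ℝ → Ω → ℝ) (t s : ℝ) (ω : Ω) : ℝ :=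
  totalAmount T D L (t + s) ω - totalAmount T D L t ω

/-- The reported number `N̂(t) = #{k : T_k + D_k ≤ t, T_k ∈ [0, 1]}`, almost surely the
cardinality of a finite set. -/
def reported (T : ℕ → Ω → ℝ≥0∞) (D : ℕ → Ω → ℝ) (t : ℝ) (ω : Ω) : ℕ :=
  {k : ℕ | T k ω ≤ 1 ∧ (T k ω).toReal + D k ω ≤ t}.ncard

/-- The law `P(· ∣ N̂(t) = ℓ)`. -/
def condReported (P : Measure Ω) (T : ℕ → Ω → ℝ≥0∞) (D : ℕ → Ω → ℝ) (t : ℝ) (ℓ : ℕ) : Measure Ω :=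
  ProbabilityTheory.cond P {ω | reported T D t ω = ℓ}

/-- `E[N̂(t)]`. -/
def meanReported (P : Measure Ω) (T : ℕ → Ω → ℝ≥0∞) (D : ℕ → Ω → ℝ) (t : ℝ) : ℝ :=
  ∫ ω, (reported T D t ω : ℝ) ∂P

/-- `E[X(a, b]^i]`, where `X(a, b] = X(b) - X(a)`. -/
def incrementMoment (P : Measure Ω) (X : ℝ → Ω → ℝ) (i : ℕ) (a b : ℝ) : ℝ :=
  ∫ ω, (X b ω - X a ω) ^ i ∂P

/-- `E[X(u)^i]`. -/
def moment (P : Measure Ω) (X : ℝ → Ω → ℝ) (i : ℕ) (u : ℝ) : ℝ :=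
  ∫ ω, (X u ω) ^ i ∂P

/-- `Λ * F_D`, the convolution of `Λ` on `[0, 1]` with `F_D`. -/
def reportMeasure (Λ FD : Measure ℝ) : Measure ℝ :=
  Measure.conv (Λ.restrict (Icc 0 1)) FD

/-- `J_i = ∫_{[0,t]} E[X(t-u, t+s-u]^i] (Λ * F_D)(du) / E[N̂(t)]`, with `m = E[N̂(t)]`. -/
def J (P : Measure Ω) (Λ FD : Measure ℝ) (m : ℝ) (X : ℝ → Ω → ℝ) (t s : ℝ) (i : ℕ) : ℝ :=
  (∫ u in Icc 0 t, incrementMoment P X i (t - u) (t + s - u) ∂(reportMeasure Λ FD)) / m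

/-- `H_i = ∫_{[0,1]} ∫_{(t-v, t+s-v]} E[X(t+s-v-r)^i] F_D(dr) Λ(dv)`. -/
def H (P : Measure Ω) (Λ FD : Measure ℝ) (X : ℝ → Ω → ℝ) (t s : ℝ) (i : ℕ) : ℝ :=
  ∫ v in Icc (0 : ℝ) 1, ∫ r in Ioc (t - v) (t + s - v), moment P X i (t + s - v - r) ∂FD ∂Λ

/-- The integrals in `J_i` and `H_i` converge absolutely. -/
def IntegralsConverge (P : Measure Ω) (Λ FD : Measure ℝ) (X : ℝ → Ω → ℝ) (t s : ℝ) (i : ℕ) :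
    Prop :=
  IntegrableOn (fun u => incrementMoment P X i (t - u) (t + s - u)) (Icc 0 t)
      (reportMeasure Λ FD) ∧
    IntegrableOn (fun z : ℝ × ℝ => moment P X i (t + s - z.1 - z.2))
      {z : ℝ × ℝ | z.1 ∈ Icc (0 : ℝ) 1 ∧ z.2 ∈ Ioc (t - z.1) (t + s - z.1)} (Λ.prod FD)

end DelayedCluster

end

set_option linter.unusedSectionVars false

namespace DelayedCluster

open scoped NNReal

variable {Ω : Type*} [MeasurableSpace Ω]

/-! Put S_j = T_j + D_j for T_j ≤ 1, μ = `reportMeasure Λ FD` and m_i(u) = E[L(t-u, t+s-u]^i]. Given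
arrivals and delays, M(t, t+s] is a.s. a finite sum of independent cluster increments, with mean ∑
m_1(S_j) and variance ∑ (m_2 - m_1²)(S_j). The event N̂(t) = ℓ depends on arrivals and delays only,
so conditioning on it does not disturb the clusters. What remains is to find the mean and variance
of sums ∑ f(S_j) given that exactly ℓ of the S_j lie in A = (-∞, t].

Heuristically the S_j form a Poisson process with mean measure μ: given the count in A, the points
in A are ℓ iid draws from normalised μ on A, and the points outside A are an independent Poisson
process. All of this is encoded in one formula, `IsDelayedArrivals.setLIntegral_prod_eq`: E[∏
h(S_j); count in A = ℓ] = e^{-Λ[0,1]} (∫_A h dμ)^ℓ / ℓ! · exp(∫_{Aᶜ} h dμ). It follows from the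
Poisson counts by the multinomial theorem for step functions, a monotone limit, integration over the
delays, and comparison of coefficients in a variable that marks the points in A.

For h = e^{xf} the logarithm of the right side is ℓ log ∫_A e^{xf} dμ + ∫_{Aᶜ} e^{xf} dμ + const,
and its first two derivatives at 0 are the conditional mean and variance of ∑ f(S_j). Since μ(A) =
E[N̂(t)], the part over A yields J_i; beyond t the cluster has not started at time t, so the part
over Aᶜ yields H_i. In the total variance the integrals of m_1² cancel.

Two analytic points support this. Exponential moments need f bounded, which follows from uniform
moment bounds for L on half-lines (`IsJumpAdditiveProcess.exists_forall_eLpNorm_le`). Evaluating a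
path at a random time must be measurable, which `pathEval` provides. -/

/-- The index of the first arrival after time `1`, i.e. the number of arrivals in `[0, 1]`. -/
noncomputable def arrivalCount (τ : ℕ → ℝ≥0∞) : ℕ := sInf {n | 1 < τ n}

/-- The sum of `f` over the delayed arrivals which arrived before time `1`. -/
noncomputable def atomSum {E : Type*} [AddCommMonoid E] (f : ℝ → E) (τ : ℕ → ℝ≥0∞) (d : ℕ → ℝ) :
    E :=
  ∑ j ∈ Finset.range (arrivalCount τ), f ((τ j).toReal + d j)

/-- A non-decreasing sequence of arrivals, only finitely many of them before time `1`. -/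
def IsRegular (τ : ℕ → ℝ≥0∞) : Prop := Monotone τ ∧ ∃ n, 1 < τ n

/-! ### Measurability of sums over the arrivals. -/

lemma IsRegular.le_one_iff {τ : ℕ → ℝ≥0∞} (h : IsRegular τ) (j : ℕ) :
    τ j ≤ 1 ↔ j < arrivalCount τ := by
  have hmem : 1 < τ (arrivalCount τ) := Nat.sInf_mem (s := {n | 1 < τ n}) h.2
  constructor
  · intro hj
    by_contra hlt
    exact absurd (hmem.trans_le (h.1 (not_lt.1 hlt))) (not_lt.2 hj)
  · intro hj
    by_contra hlt
    exact absurd (Nat.sInf_le (s := {n | 1 < τ n}) (not_le.1 hlt)) (not_le.2 hj)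

lemma measurable_arrivalCount : Measurable arrivalCount := by
  refine measurable_to_countable' fun n => ?_
  have hset : ∀ n, MeasurableSet {τ : ℕ → ℝ≥0∞ | 1 < τ n} := fun n =>
    measurableSet_lt measurable_const (measurable_pi_apply n)
  -- The last set accounts for `sInf ∅ = 0`: sequences that never exceed 1 are sent to 0.
  have h : arrivalCount ⁻¹' {n} =
      ({τ | 1 < τ n} ∩ ⋂ j ∈ {j | j < n}, {τ | 1 < τ j}ᶜ) ∪
        {τ | n = 0 ∧ ∀ j, ¬ 1 < τ j} := by
    ext τ
    simp only [mem_preimage, mem_singleton_iff, mem_union, mem_inter_iff, mem_ofPred_eq, mem_iInter,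
      mem_compl_iff]
    constructor
    · intro h
      by_cases hne : ∃ k, 1 < τ k
      · left
        refine ⟨h ▸ Nat.sInf_mem (s := {n | 1 < τ n}) hne, fun j hj => ?_⟩
        exact Nat.notMem_of_lt_sInf (s := {n | 1 < τ n}) (by rw [← h] at hj; exact hj)
      · right
        push Not at hne
        refine ⟨?_, fun j => not_lt.2 (hne j)⟩
        rw [← h, arrivalCount, Nat.sInf_eq_zero]
        right
        ext j
        simp [hne j]
    · rintro (⟨h1, h2⟩ | ⟨rfl, h⟩)
      · refine le_antisymm (Nat.sInf_le h1) ?_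
        by_contra hlt
        exact h2 _ (not_le.1 hlt) (Nat.sInf_mem (s := {n | 1 < τ n}) ⟨n, h1⟩)
      · rw [arrivalCount, Nat.sInf_eq_zero]
        right
        ext j
        simpa using h j
  rw [h]
  refine ((hset n).inter (.biInter (to_countable _) fun j _ => (hset j).compl)).union ?_
  by_cases hn : n = 0
  · simp only [hn, true_and, ofPred_forall]
    exact .iInter fun j => (hset j).compl
  · simp [hn]

lemma measurable_atomSum {E : Type*} [AddCommMonoid E] [MeasurableSpace E] [MeasurableAdd₂ E]
    {f : ℝ → E} (hf : Measurable f) :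
    Measurable fun x : (ℕ → ℝ≥0∞) × (ℕ → ℝ) => atomSum f x.1 x.2 := by
  have h : Measurable fun y : ℕ × ((ℕ → ℝ≥0∞) × (ℕ → ℝ)) =>
      ∑ j ∈ Finset.range y.1, f ((y.2.1 j).toReal + y.2.2 j) := by
    refine measurable_from_prod_countable_right fun n => ?_
    refine Finset.measurable_fun_sum (Finset.range n)
      (f := fun j (x : (ℕ → ℝ≥0∞) × (ℕ → ℝ)) => f ((x.1 j).toReal + x.2 j)) fun j _ => hf.comp ?_
    exact ((measurable_pi_apply j).comp measurable_fst).ennreal_toReal.add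
      ((measurable_pi_apply j).comp measurable_snd)
  exact h.comp ((measurable_arrivalCount.comp measurable_fst).prodMk measurable_id)

lemma measurable_atomSum_comp {E : Type*} [AddCommMonoid E] [MeasurableSpace E] [MeasurableAdd₂ E]
    {f : ℝ → E} (hf : Measurable f) {τ : Ω → ℕ → ℝ≥0∞} {d : Ω → ℕ → ℝ} (hτ : Measurable τ)
    (hd : Measurable d) : Measurable fun ω => atomSum f (τ ω) (d ω) :=
  (measurable_atomSum hf).comp (hτ.prodMk hd)

lemma _root_.ProbabilityTheory.IndepFun.lintegral_comp_prod {α β : Type*} [MeasurableSpace α]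
    [MeasurableSpace β] {P : Measure Ω} [IsProbabilityMeasure P] {X : Ω → α} {Y : Ω → β}
    (h : IndepFun X Y P) (hX : Measurable X) (hY : Measurable Y) {g : α × β → ℝ≥0∞}
    (hg : Measurable g) :
    ∫⁻ ω, g (X ω, Y ω) ∂P = ∫⁻ ω, ∫⁻ ω', g (X ω, Y ω') ∂P ∂P := by
  have hm := (indepFun_iff_map_prod_eq_prod_map_map hX.aemeasurable hY.aemeasurable).1 h
  have := Measure.isProbabilityMeasure_map (μ := P) hY.aemeasurable
  rw [← lintegral_map hg (hX.prodMk hY), hm, lintegral_prod _ hg.aemeasurable,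
    lintegral_map hg.lintegral_prod_right' hX]
  refine lintegral_congr fun ω => ?_
  exact lintegral_map (hg.comp measurable_prodMk_left) hY

/-! ### Finiteness of the number of arrivals in [0, 1]. -/

section Counts

variable {P : Measure Ω} [IsProbabilityMeasure P] {Λ : Measure ℝ} [IsLocallyFiniteMeasure Λ]
  {T : ℕ → Ω → ℝ≥0∞}

lemma toReal_mem_Icc {x : ℝ≥0∞} (hx : x ≤ 1) : x.toReal ∈ Icc (0 : ℝ) 1 :=
  ⟨ENNReal.toReal_nonneg, ENNReal.toReal_le_of_le_ofReal zero_le_one (by simpa using hx)⟩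

lemma le_one_of_toReal_mem {x : ℝ≥0∞} (hx : x ≠ ∞) (h : x.toReal ∈ Icc (0 : ℝ) 1) : x ≤ 1 := by
  rw [← ENNReal.ofReal_toReal hx]
  exact ENNReal.ofReal_le_one.2 h.2

lemma pointCount_eq_atomSum {ω : Ω} (h : IsRegular fun k => T k ω) {B : Set ℝ}
    (hB : B ⊆ Icc 0 1) :
    pointCount T B ω = (atomSum (B.indicator 1) (fun k => T k ω) 0 : ℕ) := by
  classical
  have hset : {k : ℕ | T k ω ≠ ∞ ∧ (T k ω).toReal ∈ B} =
      ((Finset.range (arrivalCount fun k => T k ω)).filter fun k => (T k ω).toReal ∈ B :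
        Finset ℕ) := by
    ext k
    simp only [mem_ofPred_eq, Finset.coe_filter, Finset.mem_range, ← h.le_one_iff]
    constructor
    · rintro ⟨h1, h2⟩
      exact ⟨le_one_of_toReal_mem h1 (hB h2), h2⟩
    · rintro ⟨h1, h2⟩
      exact ⟨(h1.trans_lt ENNReal.one_lt_top).ne, h2⟩
  rw [pointCount, hset, encard_coe_eq_coe_finsetCard, atomSum, Finset.card_filter]
  simp [indicator]

lemma IsPoissonArrivals.ae_monotone (hT : IsPoissonArrivals P Λ T) :
    ∀ᵐ ω ∂P, Monotone fun k => T k ω := by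
  filter_upwards [hT.increasing] with ω h
  refine monotone_nat_of_le_succ fun k => ?_
  rcases h k with h | ⟨h1, h2⟩
  · exact h.le
  · rw [h1, h2]

lemma measure_Icc_ne_top : Λ (Icc 0 1) ≠ ∞ := isCompact_Icc.measure_ne_top

lemma atomSum_indicator_Icc {τ : ℕ → ℝ≥0∞} (h : IsRegular τ) :
    atomSum ((Icc (0 : ℝ) 1).indicator (1 : ℝ → ℕ)) τ 0 = arrivalCount τ := by
  rw [atomSum, Finset.sum_congr rfl (g := fun _ => 1)]
  · simp
  · intro j hj
    have := toReal_mem_Icc ((h.le_one_iff j).2 (Finset.mem_range.1 hj))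
    simp [indicator, this.1, this.2]

/-- The events "exactly n arrivals in [0, 1]" have Poisson probabilities, which sum to 1; hence
almost surely one of them occurs and some T_n exceeds 1. -/
lemma IsPoissonArrivals.ae_isRegular (hT : IsPoissonArrivals P Λ T) :
    ∀ᵐ ω ∂P, IsRegular fun k => T k ω := by
  set U : ℕ → Set Ω := fun n => {ω | (∀ j < n, T j ω ≤ 1) ∧ 1 < T n ω} with hU
  have hUm : ∀ n, MeasurableSet (U n) := fun n => by
    simp only [hU, ofPred_and, ofPred_forall]
    exact (MeasurableSet.iInter fun j => .iInter fun _ =>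
      measurableSet_le (hT.measurable j) measurable_const).inter
      (measurableSet_lt measurable_const (hT.measurable n))
  have hUP : ∀ n, P (U n) = poissonMeasure (Λ (Icc 0 1)).toNNReal {n} := by
    intro n
    have h := hT.count_law 1 (fun _ => Icc 0 1) (fun _ => measurableSet_Icc)
      (fun i j hij => absurd (Subsingleton.elim i j) hij) (fun _ => measure_Icc_ne_top) fun _ => n
    simp only [Fin.forall_fin_one, Finset.univ_unique, Finset.prod_const, Finset.card_singleton,
      pow_one] at h
    rw [← h]
    refine measure_congr ?_
    filter_upwards [hT.ae_monotone] with ω hω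
    have key : ∀ hreg : IsRegular fun k => T k ω,
        ((U n) ω ↔ pointCount T (Icc 0 1) ω = n) := by
      intro hreg
      rw [pointCount_eq_atomSum hreg subset_rfl, atomSum_indicator_Icc hreg, Nat.cast_inj]
      change ((∀ j < n, T j ω ≤ 1) ∧ 1 < T n ω) ↔ _
      rw [← not_le, hreg.le_one_iff n]
      constructor
      · rintro ⟨h1, h2⟩
        refine le_antisymm (not_lt.1 h2) (not_lt.1 fun hlt => ?_)
        exact absurd ((hreg.le_one_iff _).1 (h1 _ hlt)) (lt_irrefl _)
      · rintro rfl
        exact ⟨fun j hj => (hreg.le_one_iff j).2 hj, lt_irrefl _⟩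
    refine propext ⟨fun hu => (key ⟨hω, n, hu.2⟩).1 hu, fun hp => ?_⟩
    -- If no T_k exceeded 1, all indices would be counted and the count would be infinite, not n.
    refine (key ⟨hω, ?_⟩).2 hp
    by_contra hall
    push Not at hall
    have : {k : ℕ | T k ω ≠ ∞ ∧ (T k ω).toReal ∈ Icc (0 : ℝ) 1} = univ :=
      eq_univ_of_forall fun k =>
        ⟨((hall k).trans_lt ENNReal.one_lt_top).ne, toReal_mem_Icc (hall k)⟩
    have hp' : pointCount T (Icc 0 1) ω = n := hp
    rw [pointCount, this] at hp'
    simp at hp'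
  have hdisj : Pairwise (Function.onFun Disjoint U) := by
    have : ∀ i j, i < j → Disjoint (U i) (U j) := fun i j hij =>
      disjoint_left.2 fun ω h1 h2 => absurd (h2.1 i hij) (not_le.2 h1.2)
    intro i j hij
    rcases lt_or_gt_of_ne hij with h | h
    · exact this i j h
    · exact (this j i h).symm
  have hone : P (⋃ n, U n) = 1 := by
    rw [measure_iUnion hdisj hUm]
    simp_rw [hUP]
    rw [← measure_iUnion (fun i j hij => by simpa [Function.onFun] using hij)
      fun n => measurableSet_singleton n]
    rw [iUnion_of_singleton, measure_univ]
  have : ∀ᵐ ω ∂P, ω ∈ ⋃ n, U n := (mem_ae_iff_prob_eq_one (.iUnion hUm)).2 hone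
  filter_upwards [this, hT.ae_monotone] with ω h1 h2
  obtain ⟨n, hn⟩ := mem_iUnion.1 h1
  exact ⟨h2, n, hn.2⟩

end Counts

/-! ### Products over Poisson arrivals, without and with delays. -/

section ProductFormulas

variable {P : Measure Ω} [IsProbabilityMeasure P] {Λ : Measure ℝ} [IsLocallyFiniteMeasure Λ]
  {T : ℕ → Ω → ℝ≥0∞}

/-- `e^{-Λ[0,1]} a^n / n!`. -/
noncomputable def poissonWeight (Λ : Measure ℝ) (n : ℕ) (a : ℝ≥0∞) : ℝ≥0∞ :=
  ENNReal.ofReal (Real.exp (-(Λ (Icc 0 1)).toReal)) * (a ^ n / n.factorial)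

lemma poissonMeasure_toNNReal_singleton {x : ℝ≥0∞} (hx : x ≠ ∞) (n : ℕ) :
    poissonMeasure x.toNNReal {n} =
      ENNReal.ofReal (Real.exp (-x.toReal)) * (x ^ n * (n.factorial : ℝ≥0∞)⁻¹) := by
  rw [poissonMeasure_singleton, mul_div_assoc, ENNReal.ofReal_mul (Real.exp_pos _).le,
    ENNReal.ofReal_div_of_pos (by positivity), ENNReal.coe_toNNReal_eq_toReal,
    ENNReal.ofReal_pow ENNReal.toReal_nonneg, ENNReal.ofReal_toReal hx, ENNReal.ofReal_natCast,
    div_eq_mul_inv]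

/-- Multinomial theorem: the factorials of the Poisson weights combine with 1/n! to the multinomial
coefficients of (∑ c_i x_i)^n. -/
lemma sum_prod_poissonMeasure {m : ℕ} (x c : Fin m → ℝ≥0∞) (hx : ∀ i, x i ≠ ∞) (n : ℕ) :
    ∑ k ∈ Finset.univ.piAntidiag n,
        (∏ i, c i ^ k i) * ∏ i, poissonMeasure (x i).toNNReal {k i} =
      ENNReal.ofReal (Real.exp (-(∑ i, x i).toReal)) * ((∑ i, c i * x i) ^ n / n.factorial) := by
  rw [Finset.sum_pow_eq_sum_piAntidiag, ENNReal.toReal_sum fun i _ => hx i, div_eq_mul_inv,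
    Finset.sum_mul, Finset.mul_sum]
  refine Finset.sum_congr rfl fun k hk => ?_
  have hk' : ∑ i, k i = n := (Finset.mem_piAntidiag.1 hk).1
  simp_rw [poissonMeasure_toNNReal_singleton (hx _), Finset.prod_mul_distrib, mul_pow]
  rw [← ENNReal.ofReal_prod_of_nonneg fun i _ => (Real.exp_pos _).le, ← Real.exp_sum,
    Finset.sum_neg_distrib, Finset.prod_mul_distrib]
  have hmul : (Nat.multinomial Finset.univ k : ℝ≥0∞) * (n.factorial : ℝ≥0∞)⁻¹ =
      ∏ i, ((k i).factorial : ℝ≥0∞)⁻¹ := by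
    have h1 := Nat.multinomial_spec Finset.univ k
    rw [hk'] at h1
    have h2 : ∏ i, ((k i).factorial : ℝ≥0∞)⁻¹ = ((∏ i, (k i).factorial : ℕ) : ℝ≥0∞)⁻¹ := by
      rw [Nat.cast_prod, ENNReal.prod_inv_distrib]
      intro i _ j _ _
      left
      simpa using Nat.factorial_ne_zero _
    rw [h2]
    refine ENNReal.eq_inv_of_mul_eq_one_left ?_
    rw [mul_right_comm, mul_comm (Nat.multinomial _ _ : ℝ≥0∞), ← Nat.cast_mul, h1]
    exact ENNReal.mul_inv_cancel (by simpa using Nat.factorial_ne_zero n) (by simp)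
  rw [← hmul]
  ring

lemma IsPoissonArrivals.measure_counts_eq (hT : IsPoissonArrivals P Λ T) {m : ℕ}
    {B : Fin m → Set ℝ} (hBm : ∀ i, MeasurableSet (B i))
    (hBd : ∀ i j, i ≠ j → Disjoint (B i) (B j)) (hB : ∀ i, B i ⊆ Icc 0 1) (k : Fin m → ℕ) :
    P {ω | (fun i => atomSum ((B i).indicator 1) (fun k => T k ω) 0) = k} =
      ∏ i, poissonMeasure (Λ (B i)).toNNReal {k i} := by
  rw [← hT.count_law m B hBm hBd
    (fun i => ((measure_mono (hB i)).trans_lt measure_Icc_ne_top.lt_top).ne) k]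
  refine measure_congr ?_
  filter_upwards [hT.ae_isRegular] with ω hω
  refine propext ?_
  change _ = _ ↔ ∀ i, pointCount T (B i) ω = k i
  simp_rw [pointCount_eq_atomSum hω (hB _), Nat.cast_inj]
  exact funext_iff

lemma sum_atomSum_indicator {τ : ℕ → ℝ≥0∞} (h : IsRegular τ) {m : ℕ} {B : Fin m → Set ℝ}
    (hBd : ∀ i j, i ≠ j → Disjoint (B i) (B j)) (hB : ⋃ i, B i = Icc 0 1) :
    ∑ i, atomSum ((B i).indicator (1 : ℝ → ℕ)) τ 0 = arrivalCount τ := by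
  simp only [atomSum]
  rw [Finset.sum_comm, Finset.sum_congr rfl (g := fun _ => 1)]
  · simp
  intro j hj
  have hmem := toReal_mem_Icc ((h.le_one_iff j).2 (Finset.mem_range.1 hj))
  rw [← hB] at hmem
  obtain ⟨i, hi⟩ := mem_iUnion.1 hmem
  rw [Finset.sum_eq_single i]
  · simp [hi]
  · intro i' _ hne
    simp only [Pi.zero_apply, add_zero]
    exact indicator_of_notMem (fun h => disjoint_left.1 (hBd _ _ hne) h hi) _
  · simp

lemma prod_eq_prod_pow_atomSum {τ : ℕ → ℝ≥0∞} (h : IsRegular τ) {m : ℕ} {B : Fin m → Set ℝ}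
    (hBd : ∀ i j, i ≠ j → Disjoint (B i) (B j)) (hB : ⋃ i, B i = Icc 0 1) {c : Fin m → ℝ≥0∞}
    {f : ℝ → ℝ≥0∞} (hf : ∀ i, ∀ u ∈ B i, f u = c i) :
    ∏ j ∈ Finset.range (arrivalCount τ), f (τ j).toReal =
      ∏ i, c i ^ atomSum ((B i).indicator (1 : ℝ → ℕ)) τ 0 := by
  simp only [atomSum, ← Finset.prod_pow_eq_pow_sum]
  rw [Finset.prod_comm]
  refine Finset.prod_congr rfl fun j hj => ?_
  have hmem := toReal_mem_Icc ((h.le_one_iff j).2 (Finset.mem_range.1 hj))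
  rw [← hB] at hmem
  obtain ⟨i, hi⟩ := mem_iUnion.1 hmem
  rw [Finset.prod_eq_single i, hf i _ hi]
  · simp [hi]
  · intro i' _ hne
    simp only [Pi.zero_apply, add_zero]
    rw [indicator_of_notMem (fun h => disjoint_left.1 (hBd _ _ hne) h hi), pow_zero]
  · simp

/-- Split the event of n arrivals by the vector k of counts in the cells B_i. On each piece the
product is the constant ∏ c_i^{k_i}, and the piece has a product of Poisson probabilities. -/
lemma IsPoissonArrivals.lintegral_prod_step (hT : IsPoissonArrivals P Λ T) {m : ℕ}
    {B : Fin m → Set ℝ} (hBm : ∀ i, MeasurableSet (B i))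
    (hBd : ∀ i j, i ≠ j → Disjoint (B i) (B j)) (hB : ⋃ i, B i = Icc 0 1) (c : Fin m → ℝ≥0∞)
    {f : ℝ → ℝ≥0∞} (hf : ∀ i, ∀ u ∈ B i, f u = c i) (n : ℕ) :
    ∫⁻ ω in {ω | arrivalCount (fun k => T k ω) = n}, ∏ j ∈ Finset.range n, f (T j ω).toReal ∂P =
      poissonWeight Λ n (∑ i, c i * Λ (B i)) := by
  have hBs : ∀ i, B i ⊆ Icc 0 1 := fun i => hB ▸ subset_iUnion B i
  have hTm : Measurable fun ω k => T k ω := measurable_pi_lambda _ hT.measurable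
  have hNm : MeasurableSet {ω | arrivalCount (fun k => T k ω) = n} :=
    (measurable_arrivalCount.comp hTm) (measurableSet_singleton n)
  set K : Ω → Fin m → ℕ := fun ω i => atomSum ((B i).indicator 1) (fun k => T k ω) 0 with hK
  have hKm : Measurable K := by
    refine measurable_pi_lambda _ fun i => ?_
    have h1 : Measurable ((B i).indicator (1 : ℝ → ℕ)) := measurable_one.indicator (hBm i)
    exact measurable_atomSum_comp h1 hTm measurable_const
  have hsum : Λ (Icc 0 1) = ∑ i, Λ (B i) := by
    rw [← hB, measure_iUnion (fun i j hij => hBd i j hij) hBm, tsum_fintype]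
  rw [poissonWeight, hsum, ← sum_prod_poissonMeasure _ _
    fun i => ((measure_mono (hBs i)).trans_lt measure_Icc_ne_top.lt_top).ne]
  have hKP : ∀ k, P {ω | K ω = k} = ∏ i, poissonMeasure (Λ (B i)).toNNReal {k i} :=
    hT.measure_counts_eq hBm hBd hBs
  rw [← lintegral_indicator hNm]
  have hset : ∀ k, MeasurableSet {ω | K ω = k} := fun k => hKm (measurableSet_singleton k)
  have hae : ∀ᵐ ω ∂P, {ω | arrivalCount (fun k => T k ω) = n}.indicator
      (fun ω => ∏ j ∈ Finset.range n, f (T j ω).toReal) ω =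
      ∑ k ∈ Finset.univ.piAntidiag n, {ω | K ω = k}.indicator (fun _ => ∏ i, c i ^ k i) ω := by
    filter_upwards [hT.ae_isRegular] with ω hω
    have hKsum : ∑ i, K ω i = arrivalCount fun k => T k ω := sum_atomSum_indicator hω hBd hB
    have hprod : ∏ j ∈ Finset.range (arrivalCount fun k => T k ω), f (T j ω).toReal =
        ∏ i, c i ^ K ω i := prod_eq_prod_pow_atomSum hω hBd hB hf
    clear_value K
    by_cases h : arrivalCount (fun k => T k ω) = n
    · have hmem : K ω ∈ Finset.univ.piAntidiag n := by simp [hKsum, h]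
      rw [indicator_of_mem (s := {ω | arrivalCount (fun k => T k ω) = n}) h,
        Finset.sum_eq_single_of_mem _ hmem,
        indicator_of_mem (s := {ω' | K ω' = K ω}) rfl, ← hprod, h]
      exact fun k _ hk => indicator_of_notMem (fun hmem => hk hmem.symm) _
    · rw [indicator_of_notMem (s := {ω | arrivalCount (fun k => T k ω) = n}) h]
      refine (Finset.sum_eq_zero fun k hk => indicator_of_notMem (fun hmem => h ?_) _).symm
      rw [← hKsum, show K ω = k from hmem]
      exact (Finset.mem_piAntidiag.1 hk).1
  rw [lintegral_congr_ae hae, lintegral_finsetSum _ fun k _ => measurable_const.indicator (hset k)]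
  refine Finset.sum_congr rfl fun k _ => ?_
  rw [lintegral_indicator (hset k), lintegral_const, Measure.restrict_apply_univ, hKP]

lemma IsPoissonArrivals.lintegral_prod_simpleFunc (hT : IsPoissonArrivals P Λ T)
    (f : SimpleFunc ℝ ℝ≥0∞) (n : ℕ) :
    ∫⁻ ω in {ω | arrivalCount (fun k => T k ω) = n}, ∏ j ∈ Finset.range n, f (T j ω).toReal ∂P =
      poissonWeight Λ n (∫⁻ u in Icc 0 1, f u ∂Λ) := by
  let e := f.range.equivFin
  have hm : ∀ c, MeasurableSet (f ⁻¹' {c} ∩ Icc 0 1) := fun c =>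
    (f.measurableSet_fiber c).inter measurableSet_Icc
  rw [hT.lintegral_prod_step (B := fun i => f ⁻¹' {(e.symm i : ℝ≥0∞)} ∩ Icc 0 1)
    (c := fun i => (e.symm i : ℝ≥0∞))]
  · rw [show ∫⁻ u in Icc 0 1, f u ∂Λ = _ from SimpleFunc.lintegral_eq_lintegral f _,
      SimpleFunc.lintegral, ← Finset.sum_coe_sort f.range,
      ← Equiv.sum_comp e.symm fun x : f.range => (x : ℝ≥0∞) * _]
    simp_rw [Measure.restrict_apply (f.measurableSet_fiber _)]
  · exact fun i => hm _
  · intro i j hij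
    refine disjoint_left.2 fun u hi hj => hij ?_
    have h1 : f u = e.symm i := hi.1
    have h2 : f u = e.symm j := hj.1
    exact e.symm.injective (Subtype.ext (h1.symm.trans h2))
  · ext u
    simp only [mem_iUnion, mem_inter_iff, mem_preimage, mem_singleton_iff, exists_and_right,
      and_iff_right_iff_imp]
    exact fun _ => ⟨e ⟨f u, f.mem_range_self u⟩, by simp⟩
  · exact fun i u hu => hu.1

lemma continuous_poissonWeight (n : ℕ) : Continuous (poissonWeight Λ n) := by
  unfold poissonWeight
  refine ENNReal.continuous_const_mul ENNReal.ofReal_ne_top |>.comp ?_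
  exact (ENNReal.continuous_div_const _ (by simpa using Nat.factorial_ne_zero n)).comp
    (ENNReal.continuous_pow n)

/-- Monotone limit of simple functions from below. Finiteness of f is needed because multiplication
in `ℝ≥0∞` is not continuous at (0, ∞). -/
lemma IsPoissonArrivals.lintegral_prod (hT : IsPoissonArrivals P Λ T) {f : ℝ → ℝ≥0∞}
    (hf : Measurable f) (hfin : ∀ u, f u ≠ ∞) (n : ℕ) :
    ∫⁻ ω in {ω | arrivalCount (fun k => T k ω) = n}, ∏ j ∈ Finset.range n, f (T j ω).toReal ∂P =
      poissonWeight Λ n (∫⁻ u in Icc 0 1, f u ∂Λ) := by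
  have hlim : ∀ u, Tendsto (fun k => SimpleFunc.eapprox f k u) atTop (𝓝 (f u)) := by
    intro u
    conv => rhs; rw [← SimpleFunc.iSup_eapprox_apply hf u]
    exact tendsto_atTop_iSup fun a b hab => SimpleFunc.monotone_eapprox f hab u
  have h1 := lintegral_tendsto_of_tendsto_of_monotone
    (μ := P.restrict {ω | arrivalCount (fun k => T k ω) = n})
    (f := fun k ω => ∏ j ∈ Finset.range n, SimpleFunc.eapprox f k (T j ω).toReal)
    (F := fun ω => ∏ j ∈ Finset.range n, f (T j ω).toReal)
    (fun k => (Finset.measurable_fun_prod _ fun j _ =>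
      (SimpleFunc.eapprox f k).measurable.comp (hT.measurable j).ennreal_toReal).aemeasurable)
    (ae_of_all _ fun ω a b hab => Finset.prod_le_prod' fun j _ =>
      SimpleFunc.monotone_eapprox f hab _)
    (ae_of_all _ fun ω => ENNReal.tendsto_finsetProd_of_ne_top _ (fun j _ => hlim _)
      fun j _ => hfin _)
  have h2 := lintegral_tendsto_of_tendsto_of_monotone (μ := Λ.restrict (Icc 0 1))
    (f := fun k u => SimpleFunc.eapprox f k u) (F := f)
    (fun k => (SimpleFunc.eapprox f k).measurable.aemeasurable)
    (ae_of_all _ fun u a b hab => SimpleFunc.monotone_eapprox f hab u) (ae_of_all _ hlim)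
  simp_rw [hT.lintegral_prod_simpleFunc] at h1
  exact tendsto_nhds_unique h1 (((continuous_poissonWeight n).tendsto _).comp h2)

/-- The delays are independent of the arrivals and of each other, so integrating them out replaces f
by φ(u) = ∫ f(u + r) F_D(dr). The Λ-integral of φ over [0, 1] is the μ-integral of f by definition
of convolution. The bound C keeps φ finite. -/
lemma IsPoissonArrivals.lintegral_prod_delayed (hT : IsPoissonArrivals P Λ T) {D : ℕ → Ω → ℝ}
    {FD : Measure ℝ} [IsProbabilityMeasure FD] (hDm : ∀ k, Measurable (D k))
    (hDlaw : ∀ k, P.map (D k) = FD) (hDindep : iIndepFun D P)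
    (hTD : IndepFun (fun ω k => T k ω) (fun ω k => D k ω) P)
    {f : ℝ → ℝ≥0∞} (hf : Measurable f) {C : ℝ≥0∞} (hC : C ≠ ∞) (hfC : ∀ u, f u ≤ C) (n : ℕ) :
    ∫⁻ ω in {ω | arrivalCount (fun k => T k ω) = n},
        ∏ j ∈ Finset.range n, f ((T j ω).toReal + D j ω) ∂P =
      poissonWeight Λ n (∫⁻ u, f u ∂(reportMeasure Λ FD)) := by
  have hTm : Measurable fun ω k => T k ω := measurable_pi_lambda _ hT.measurable
  have hDm' : Measurable fun ω k => D k ω := measurable_pi_lambda _ hDm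
  have hNm : MeasurableSet {ω | arrivalCount (fun k => T k ω) = n} :=
    (measurable_arrivalCount.comp hTm) (measurableSet_singleton n)
  set g : (ℕ → ℝ≥0∞) × (ℕ → ℝ) → ℝ≥0∞ := {x | arrivalCount x.1 = n}.indicator
    fun x => ∏ j ∈ Finset.range n, f ((x.1 j).toReal + x.2 j) with hg
  have hgm : Measurable g := by
    refine Measurable.indicator ?_
      ((measurable_arrivalCount.comp measurable_fst) (measurableSet_singleton n))
    exact Finset.measurable_fun_prod _ fun j _ => hf.comp <|
      ((measurable_pi_apply j).comp measurable_fst).ennreal_toReal.add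
        ((measurable_pi_apply j).comp measurable_snd)
  set φ : ℝ → ℝ≥0∞ := fun u => ∫⁻ r, f (u + r) ∂FD with hφ
  have hφm : Measurable φ := Measurable.lintegral_prod_right' (f := fun z : ℝ × ℝ => f (z.1 + z.2))
    (hf.comp (measurable_fst.add measurable_snd))
  have hφC : ∀ u, φ u ≠ ∞ := fun u => ne_top_of_le_ne_top hC <|
    (lintegral_mono fun r => hfC (u + r)).trans (by simp)
  have h1 := hTD.lintegral_comp_prod hTm hDm' hgm
  have h2 : ∀ ω, ∫⁻ ω', g (fun k => T k ω, fun k => D k ω') ∂P =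
      {ω | arrivalCount (fun k => T k ω) = n}.indicator
        (fun ω => ∏ j ∈ Finset.range n, φ (T j ω).toReal) ω := by
    intro ω
    by_cases hω : arrivalCount (fun k => T k ω) = n
    · simp only [hg, indicator, mem_ofPred_eq, hω, if_true]
      rw [lintegral_prod_eq_prod_lintegral_of_indepFun _
        (fun j ω' => f ((T j ω).toReal + D j ω'))
        (hDindep.comp (fun j r => f ((T j ω).toReal + r))
          fun j => hf.comp (measurable_const_add _))
        fun j => hf.comp ((hDm j).const_add _)]
      refine Finset.prod_congr rfl fun j _ => ?_
      rw [hφ, ← hDlaw j]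
      exact (lintegral_map (hf.comp (measurable_const_add _)) (hDm j)).symm
    · simp [hg, indicator, hω]
  have h3 : ∀ ω, g (fun k => T k ω, fun k => D k ω) =
      {ω | arrivalCount (fun k => T k ω) = n}.indicator
        (fun ω => ∏ j ∈ Finset.range n, f ((T j ω).toReal + D j ω)) ω := fun ω => by
    simp [hg, indicator]
  simp_rw [h2, h3, lintegral_indicator hNm] at h1
  rw [h1, hT.lintegral_prod hφm hφC, reportMeasure, Measure.lintegral_conv hf]

end ProductFormulas

/-- Two real polynomials that agree at all positive z coincide; finiteness of the coefficients
allows the passage to the reals. This extracts the count in A from a generating function. -/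
lemma _root_.ENNReal.eq_of_forall_sum_pow_mul_eq {n : ℕ} {c d : ℕ → ℝ≥0∞} (hc : ∀ i, c i ≠ ∞)
    (hd : ∀ i, d i ≠ ∞)
    (h : ∀ z : NNReal, ∑ i ∈ Finset.range n, (z : ℝ≥0∞) ^ i * c i =
      ∑ i ∈ Finset.range n, (z : ℝ≥0∞) ^ i * d i) {i : ℕ} (hi : i < n) : c i = d i := by
  let p : (ℕ → ℝ≥0∞) → Polynomial ℝ := fun c =>
    ∑ i ∈ Finset.range n, Polynomial.monomial i (c i).toReal
  have hcoeff : ∀ c : ℕ → ℝ≥0∞, (p c).coeff i = (c i).toReal := by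
    intro c
    simp only [p, Polynomial.finsetSum_coeff, Polynomial.coeff_monomial]
    rw [Finset.sum_ite_eq' (Finset.range n) i, if_pos (Finset.mem_range.2 hi)]
  have heval : ∀ c : ℕ → ℝ≥0∞, (∀ i, c i ≠ ∞) → ∀ z : NNReal,
      (p c).eval (z : ℝ) = (∑ i ∈ Finset.range n, (z : ℝ≥0∞) ^ i * c i).toReal := by
    intro c hc z
    rw [ENNReal.toReal_sum fun i _ => ENNReal.mul_ne_top (by simp) (hc i)]
    simp [p, Polynomial.eval_finsetSum, mul_comm]
  have hp : p c = p d := by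
    refine Polynomial.eq_of_infinite_eval_eq _ _ ((Ioi_infinite (0 : ℝ)).mono fun z hz => ?_)
    lift z to NNReal using (le_of_lt hz)
    simp only [mem_ofPred_eq]
    rw [heval c hc, heval d hd, h]
  rw [← ENNReal.toReal_eq_toReal_iff' (hc i) (hd i), ← hcoeff c, hp, hcoeff]

/-- The arrivals `T` are Poisson with mean measure `Λ` and the delays `D` are iid with law `FD` and
independent of the arrivals. -/
structure IsDelayedArrivals (P : Measure Ω) (Λ FD : Measure ℝ) (T : ℕ → Ω → ℝ≥0∞)
    (D : ℕ → Ω → ℝ) : Prop where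
  arrivals : IsPoissonArrivals P Λ T
  measurable : ∀ k, Measurable (D k)
  map_eq : ∀ k, P.map (D k) = FD
  iIndepFun : iIndepFun D P
  indepFun : IndepFun (fun ω k => T k ω) (fun ω k => D k ω) P

/-! ### Product formula on the event of ℓ delayed arrivals in a set. -/

section ConditionedSums

variable {P : Measure Ω} [IsProbabilityMeasure P] {Λ FD : Measure ℝ} [IsLocallyFiniteMeasure Λ]
  [IsProbabilityMeasure FD] {T : ℕ → Ω → ℝ≥0∞} {D : ℕ → Ω → ℝ}

lemma IsDelayedArrivals.measurable_atomSum {E : Type*} [AddCommMonoid E] [MeasurableSpace E]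
    [MeasurableAdd₂ E] (h : IsDelayedArrivals P Λ FD T D) {f : ℝ → E} (hf : Measurable f) :
    Measurable fun ω => atomSum f (fun k => T k ω) fun k => D k ω :=
  measurable_atomSum_comp hf (measurable_pi_lambda _ h.arrivals.measurable)
    (measurable_pi_lambda _ h.measurable)

instance : IsFiniteMeasure (reportMeasure Λ FD) := by
  have : IsFiniteMeasure (Λ.restrict (Icc 0 1)) := ⟨by simpa using measure_Icc_ne_top.lt_top⟩
  unfold reportMeasure
  infer_instance

variable {A : Set ℝ} {h : ℝ → ℝ≥0∞} {C : ℝ≥0∞}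

/-- Give each point in A an extra weight z. The product over the n points then acquires the factor
z^(count in A), while the μ-integral becomes z a + b. The coefficient of z^ℓ in (z a + b)^n is the
claim. -/
lemma IsDelayedArrivals.setLIntegral_count_eq (hTD : IsDelayedArrivals P Λ FD T D)
    (hA : MeasurableSet A) (hh : Measurable h) (hC : C ≠ ∞) (hhC : ∀ u, h u ≤ C) (n ℓ : ℕ)
    (hℓ : ℓ ≤ n) :
    ∫⁻ ω in {ω | arrivalCount (fun k => T k ω) = n},
        {ω | atomSum (A.indicator (1 : ℝ → ℕ)) (fun k => T k ω) (fun k => D k ω) = ℓ}.indicator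
          (fun ω => ∏ j ∈ Finset.range n, h ((T j ω).toReal + D j ω)) ω ∂P =
      poissonWeight Λ n 1 * ((∫⁻ u in A, h u ∂(reportMeasure Λ FD)) ^ ℓ *
        (∫⁻ u in Aᶜ, h u ∂(reportMeasure Λ FD)) ^ (n - ℓ) * n.choose ℓ) := by
  classical
  set a := ∫⁻ u in A, h u ∂(reportMeasure Λ FD) with ha
  set b := ∫⁻ u in Aᶜ, h u ∂(reportMeasure Λ FD) with hb
  have hfin : ∀ B : Set ℝ, ∫⁻ u in B, h u ∂(reportMeasure Λ FD) ≠ ∞ := fun B =>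
    ne_top_of_le_ne_top (ENNReal.mul_ne_top hC (measure_ne_top (reportMeasure Λ FD) B))
      ((lintegral_mono hhC).trans (by simp))
  set R : Ω → ℕ := fun ω => atomSum (A.indicator (1 : ℝ → ℕ)) (fun k => T k ω) (fun k => D k ω)
    with hR
  have hRm : Measurable R := hTD.measurable_atomSum (measurable_one.indicator hA)
  have hRset : ∀ ℓ, MeasurableSet {ω | R ω = ℓ} := fun ℓ => hRm (measurableSet_singleton ℓ)
  set W : Ω → ℝ≥0∞ := fun ω => ∏ j ∈ Finset.range n, h ((T j ω).toReal + D j ω) with hW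
  have hSm : ∀ j, Measurable fun ω => (T j ω).toReal + D j ω := fun j =>
    (hTD.arrivals.measurable j).ennreal_toReal.add (hTD.measurable j)
  have hWm : Measurable W := Finset.measurable_fun_prod _ fun j _ => hh.comp (hSm j)
  have hNm : MeasurableSet {ω | arrivalCount (fun k => T k ω) = n} :=
    (measurable_arrivalCount.comp (measurable_pi_lambda _ hTD.arrivals.measurable))
      (measurableSet_singleton n)
  have hWC : ∀ ω, W ω ≤ C ^ n := fun ω => by
    simpa [W] using Finset.prod_le_prod' (s := Finset.range n)
      fun j _ => hhC ((T j ω).toReal + D j ω)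
  refine ENNReal.eq_of_forall_sum_pow_mul_eq (n := n + 1) (i := ℓ)
    (c := fun ℓ => ∫⁻ ω in {ω | arrivalCount (fun k => T k ω) = n},
      {ω | R ω = ℓ}.indicator W ω ∂P)
    (d := fun ℓ => poissonWeight Λ n 1 * (a ^ ℓ * b ^ (n - ℓ) * n.choose ℓ))
    (fun i => ?_) (fun i => ?_) (fun z => ?_) (Nat.lt_succ_of_le hℓ)
  · refine ne_top_of_le_ne_top (ENNReal.pow_ne_top (n := n) hC)
      ((lintegral_mono fun ω => (indicator_le_self _ W ω).trans (hWC ω)).trans ?_)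
    rw [lintegral_const]
    exact mul_le_of_le_one_right' ((Measure.restrict_apply_univ _).trans_le prob_le_one)
  · refine ENNReal.mul_ne_top (ENNReal.mul_ne_top ENNReal.ofReal_ne_top ?_)
      (ENNReal.mul_ne_top (ENNReal.mul_ne_top (ENNReal.pow_ne_top (hfin A))
        (ENNReal.pow_ne_top (hfin Aᶜ))) (by simp))
    exact ENNReal.div_ne_top (by simp) (by simpa using Nat.factorial_ne_zero n)
  · have hφm : Measurable fun u => h u * if u ∈ A then (z : ℝ≥0∞) else 1 :=
      hh.mul (Measurable.ite hA measurable_const measurable_const)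
    have key := hTD.arrivals.lintegral_prod_delayed hTD.measurable hTD.map_eq hTD.iIndepFun
      hTD.indepFun hφm (C := C * max z 1) (ENNReal.mul_ne_top hC (by simp))
      (fun u => mul_le_mul' (hhC u) (by split_ifs <;> simp)) n
    have hint : ∫⁻ u, h u * (if u ∈ A then (z : ℝ≥0∞) else 1) ∂(reportMeasure Λ FD) =
        z * a + b := by
      rw [← lintegral_add_compl _ hA, ha, hb, ← lintegral_const_mul _ hh]
      congr 1
      · refine setLIntegral_congr_fun hA fun u hu => ?_
        simp [hu, mul_comm]
      · refine setLIntegral_congr_fun hA.compl fun u hu => ?_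
        simp [show u ∉ A from hu]
    rw [hint] at key
    simp_rw [← lintegral_const_mul _ (hWm.indicator (hRset _))]
    rw [← lintegral_finsetSum _ fun i _ => (hWm.indicator (hRset i)).const_mul _]
    refine Eq.trans (setLIntegral_congr_fun hNm fun ω hω => ?_) (key.trans ?_)
    · have hω' : arrivalCount (fun k => T k ω) = n := hω
      have hRsum : R ω = ∑ j ∈ Finset.range n, A.indicator (1 : ℝ → ℕ) ((T j ω).toReal + D j ω) := by
        simp only [hR, atomSum, hω']
      have hRn : R ω ≤ n := by
        rw [hRsum]
        refine (Finset.sum_le_card_nsmul _ _ 1 fun j _ => ?_).trans (by simp)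
        exact indicator_le_self' (fun _ _ => Nat.zero_le _) _
      rw [Finset.sum_eq_single_of_mem (R ω) (Finset.mem_range.2 (Nat.lt_succ_of_le hRn)),
        indicator_of_mem (s := {ω' | R ω' = R ω}) rfl, Finset.prod_mul_distrib, mul_comm, hRsum,
        ← Finset.prod_pow_eq_pow_sum]
      · congr 1
        refine Finset.prod_congr rfl fun j _ => ?_
        by_cases hj : (T j ω).toReal + D j ω ∈ A <;> simp [hj]
      · intro i _ hi
        rw [indicator_of_notMem (s := {ω | R ω = i}) (fun hmem => hi (Eq.symm hmem)), mul_zero]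
    · rw [poissonWeight, poissonWeight, add_pow, one_pow, div_eq_mul_inv, Finset.sum_mul,
        Finset.mul_sum]
      refine Finset.sum_congr rfl fun i _ => ?_
      rw [mul_pow, one_div]
      ring

lemma tsum_pow_div_factorial {b : ℝ≥0∞} (hb : b ≠ ∞) :
    ∑' n : ℕ, b ^ n / n.factorial = ENNReal.ofReal (Real.exp b.toReal) := by
  have h := NormedSpace.expSeries_div_hasSum_exp (b.toReal)
  rw [← Real.exp_eq_exp_ℝ] at h
  rw [← h.tsum_eq, ENNReal.ofReal_tsum_of_nonneg (fun n => by positivity) h.summable]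
  refine tsum_congr fun n => ?_
  rw [ENNReal.ofReal_div_of_pos (by positivity), ENNReal.ofReal_pow ENNReal.toReal_nonneg,
    ENNReal.ofReal_toReal hb, ENNReal.ofReal_natCast]

/-- Sum the preceding formula over the total number n + ℓ of arrivals: binom(n+ℓ, ℓ)/(n+ℓ)! = 1/(ℓ!
n!), so the points outside A contribute an exponential series. -/
lemma IsDelayedArrivals.setLIntegral_prod_eq (hTD : IsDelayedArrivals P Λ FD T D)
    (hA : MeasurableSet A) (hh : Measurable h) (hC : C ≠ ∞) (hhC : ∀ u, h u ≤ C) (ℓ : ℕ) :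
    ∫⁻ ω in {ω | atomSum (A.indicator (1 : ℝ → ℕ)) (fun k => T k ω) (fun k => D k ω) = ℓ},
        ∏ j ∈ Finset.range (arrivalCount fun k => T k ω), h ((T j ω).toReal + D j ω) ∂P =
      ENNReal.ofReal (Real.exp (-(Λ (Icc 0 1)).toReal)) *
        ((∫⁻ u in A, h u ∂(reportMeasure Λ FD)) ^ ℓ / ℓ.factorial) *
        ENNReal.ofReal (Real.exp (∫⁻ u in Aᶜ, h u ∂(reportMeasure Λ FD)).toReal) := by
  have hfin : ∀ B : Set ℝ, ∫⁻ u in B, h u ∂(reportMeasure Λ FD) ≠ ∞ := fun B =>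
    ne_top_of_le_ne_top (ENNReal.mul_ne_top hC (measure_ne_top (reportMeasure Λ FD) B))
      ((lintegral_mono hhC).trans (by simp))
  have hRset : MeasurableSet
      {ω | atomSum (A.indicator (1 : ℝ → ℕ)) (fun k => T k ω) (fun k => D k ω) = ℓ} :=
    (hTD.measurable_atomSum (measurable_one.indicator hA)) (measurableSet_singleton ℓ)
  have hN : Measurable fun ω => arrivalCount fun k => T k ω :=
    measurable_arrivalCount.comp (measurable_pi_lambda _ hTD.arrivals.measurable)
  have hNset : ∀ n, MeasurableSet {ω | arrivalCount (fun k => T k ω) = n} := fun n =>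
    hN (measurableSet_singleton n)
  rw [← lintegral_indicator hRset, ← setLIntegral_univ,
    show (univ : Set Ω) = ⋃ n, {ω | arrivalCount (fun k => T k ω) = n} from
      (iUnion_eq_univ_iff.2 fun ω => ⟨arrivalCount fun k => T k ω, rfl⟩).symm,
    lintegral_iUnion hNset fun i j hij => disjoint_left.2 fun ω h1 h2 => hij (h1.symm.trans h2)]
  have hterm : ∀ n, ∫⁻ ω in {ω | arrivalCount (fun k => T k ω) = n},
      {ω | atomSum (A.indicator (1 : ℝ → ℕ)) (fun k => T k ω) (fun k => D k ω) = ℓ}.indicator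
        (fun ω => ∏ j ∈ Finset.range (arrivalCount fun k => T k ω),
          h ((T j ω).toReal + D j ω)) ω ∂P =
      ∫⁻ ω in {ω | arrivalCount (fun k => T k ω) = n},
      {ω | atomSum (A.indicator (1 : ℝ → ℕ)) (fun k => T k ω) (fun k => D k ω) = ℓ}.indicator
        (fun ω => ∏ j ∈ Finset.range n, h ((T j ω).toReal + D j ω)) ω ∂P := by
    intro n
    refine setLIntegral_congr_fun (hNset n) fun ω hω => ?_
    have hω' : arrivalCount (fun k => T k ω) = n := hω
    simp only [indicator, hω']
  simp_rw [hterm]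
  -- Fewer than ℓ arrivals cannot put ℓ points into A, so the first ℓ terms vanish.
  rw [← Summable.sum_add_tsum_nat_add' (k := ℓ) ENNReal.summable,
    Finset.sum_eq_zero, zero_add, ← tsum_pow_div_factorial (hfin Aᶜ), ← ENNReal.tsum_mul_left]
  · refine tsum_congr fun n => ?_
    rw [hTD.setLIntegral_count_eq hA hh hC hhC _ _ (Nat.le_add_left ℓ n), Nat.add_sub_cancel,
      poissonWeight, one_pow]
    have hch : ((n + ℓ).choose ℓ : ℝ≥0∞) * ((n + ℓ).factorial : ℝ≥0∞)⁻¹ =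
        (ℓ.factorial : ℝ≥0∞)⁻¹ * (n.factorial : ℝ≥0∞)⁻¹ := by
      rw [← ENNReal.mul_inv (by simp) (by simp)]
      refine ENNReal.eq_inv_of_mul_eq_one_left ?_
      have := Nat.add_choose_mul_factorial_mul_factorial n ℓ
      rw [mul_right_comm, ← Nat.cast_mul, ← Nat.cast_mul,
        show (n + ℓ).choose ℓ * (ℓ.factorial * n.factorial) = (n + ℓ).factorial by
          rw [← this]; ring]
      exact ENNReal.mul_inv_cancel (by simpa using Nat.factorial_ne_zero _) (by simp)
    rw [one_div, div_eq_mul_inv, div_eq_mul_inv]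
    calc _ = ENNReal.ofReal (Real.exp (-(Λ (Icc 0 1)).toReal)) *
          (∫⁻ u in A, h u ∂(reportMeasure Λ FD)) ^ ℓ *
          (∫⁻ u in Aᶜ, h u ∂(reportMeasure Λ FD)) ^ n *
          (((n + ℓ).choose ℓ : ℝ≥0∞) * ((n + ℓ).factorial : ℝ≥0∞)⁻¹) := by ring
      _ = _ := by rw [hch]; ring
  · intro n hn
    rw [setLIntegral_congr_fun (g := 0) (hNset n)]
    · simp
    intro ω hω
    have hω' : arrivalCount (fun k => T k ω) = n := hω
    refine indicator_of_notMem (fun hmem => ?_) _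
    have hmem' : atomSum (A.indicator (1 : ℝ → ℕ)) (fun k => T k ω) (fun k => D k ω) = ℓ := hmem
    have : ℓ ≤ n := by
      rw [← hmem', atomSum, hω']
      refine (Finset.sum_le_card_nsmul _ _ 1 fun j _ => ?_).trans (by simp)
      exact indicator_le_self' (fun _ _ => Nat.zero_le _) _
    exact absurd (Finset.mem_range.1 hn) (not_lt.2 this)

end ConditionedSums

lemma integrableExpSet_eq_univ_of_bound {α : Type*} [MeasurableSpace α] {μ : Measure α}
    [IsFiniteMeasure μ] {f : α → ℝ} (hf : Measurable f) {C : ℝ} (hC : ∀ u, |f u| ≤ C) :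
    integrableExpSet f μ = univ := by
  refine eq_univ_of_forall fun x => ?_
  refine Integrable.of_bound (by fun_prop) (Real.exp (|x| * C)) (ae_of_all _ fun u => ?_)
  rw [Real.norm_eq_abs, Real.abs_exp, Real.exp_le_exp]
  calc x * f u ≤ |x * f u| := le_abs_self _
    _ = |x| * |f u| := abs_mul _ _
    _ ≤ |x| * C := by gcongr; exact hC u

/-! ### Cumulants of conditioned sums. -/

section ConditionedSums

variable {P : Measure Ω} [IsProbabilityMeasure P] {Λ FD : Measure ℝ} [IsLocallyFiniteMeasure Λ]
  [IsProbabilityMeasure FD] {T : ℕ → Ω → ℝ≥0∞} {D : ℕ → Ω → ℝ} {A : Set ℝ} {f : ℝ → ℝ} {C : ℝ}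

/-- The event that exactly `ℓ` of the delayed arrivals are in `A`. -/
def countEvent (T : ℕ → Ω → ℝ≥0∞) (D : ℕ → Ω → ℝ) (A : Set ℝ) (ℓ : ℕ) : Set Ω :=
  {ω | atomSum (A.indicator (1 : ℝ → ℕ)) (fun k => T k ω) (fun k => D k ω) = ℓ}

lemma IsDelayedArrivals.lintegral_exp_atomSum (h : IsDelayedArrivals P Λ FD T D)
    (hA : MeasurableSet A) (hf : Measurable f) (hC : ∀ u, |f u| ≤ C) (ℓ : ℕ) (x : ℝ) :
    ∫⁻ ω in countEvent T D A ℓ,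
        ENNReal.ofReal (Real.exp (x * atomSum f (fun k => T k ω) fun k => D k ω)) ∂P =
      ENNReal.ofReal (Real.exp (-(Λ (Icc 0 1)).toReal) *
        (mgf f ((reportMeasure Λ FD).restrict A) x ^ ℓ / ℓ.factorial) *
        Real.exp (mgf f ((reportMeasure Λ FD).restrict Aᶜ) x)) := by
  have hmgf : ∀ B : Set ℝ, ∫⁻ u in B, ENNReal.ofReal (Real.exp (x * f u)) ∂(reportMeasure Λ FD) =
      ENNReal.ofReal (mgf f ((reportMeasure Λ FD).restrict B) x) := by
    intro B
    rw [mgf, ofReal_integral_eq_lintegral_ofReal]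
    · have : x ∈ integrableExpSet f ((reportMeasure Λ FD).restrict B) := by
        rw [integrableExpSet_eq_univ_of_bound hf hC]; trivial
      exact this
    · exact ae_of_all _ fun u => (Real.exp_pos _).le
  have hbound : ∀ u, ENNReal.ofReal (Real.exp (x * f u)) ≤ ENNReal.ofReal (Real.exp (|x| * C)) := by
    intro u
    refine ENNReal.ofReal_le_ofReal (Real.exp_le_exp.2 ?_)
    calc x * f u ≤ |x * f u| := le_abs_self _
      _ = |x| * |f u| := abs_mul _ _
      _ ≤ |x| * C := by gcongr; exact hC u
  have key := h.setLIntegral_prod_eq hA (h := fun u => ENNReal.ofReal (Real.exp (x * f u)))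
    (by fun_prop) ENNReal.ofReal_ne_top hbound ℓ
  rw [hmgf, hmgf, ENNReal.toReal_ofReal mgf_nonneg] at key
  have hnonneg := mgf_nonneg (X := f) (μ := (reportMeasure Λ FD).restrict A) (t := x)
  rw [ENNReal.ofReal_mul (by positivity),
    ENNReal.ofReal_mul (Real.exp_pos _).le,
    ENNReal.ofReal_div_of_pos (by positivity), ENNReal.ofReal_pow mgf_nonneg,
    ENNReal.ofReal_natCast, ← key]
  refine lintegral_congr fun ω => ?_
  rw [← ENNReal.ofReal_prod_of_nonneg fun _ _ => (Real.exp_pos _).le, ← Real.exp_sum, atomSum,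
    Finset.mul_sum]

lemma IsDelayedArrivals.integrableExpSet_atomSum (h : IsDelayedArrivals P Λ FD T D)
    (hA : MeasurableSet A) (hf : Measurable f) (hC : ∀ u, |f u| ≤ C) (ℓ : ℕ) :
    integrableExpSet (fun ω => atomSum f (fun k => T k ω) fun k => D k ω)
      (P.restrict (countEvent T D A ℓ)) = univ := by
  refine eq_univ_of_forall fun x => ?_
  have hm := h.measurable_atomSum hf
  refine ⟨(Real.measurable_exp.comp (hm.const_mul x)).aestronglyMeasurable, ?_⟩
  rw [hasFiniteIntegral_iff_ofReal (ae_of_all _ fun u => (Real.exp_pos _).le),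
    h.lintegral_exp_atomSum hA hf hC]
  exact ENNReal.ofReal_lt_top

lemma IsDelayedArrivals.mgf_atomSum (h : IsDelayedArrivals P Λ FD T D)
    (hA : MeasurableSet A) (hf : Measurable f) (hC : ∀ u, |f u| ≤ C) (ℓ : ℕ) (x : ℝ) :
    mgf (fun ω => atomSum f (fun k => T k ω) fun k => D k ω) (P.restrict (countEvent T D A ℓ)) x =
      Real.exp (-(Λ (Icc 0 1)).toReal) *
        (mgf f ((reportMeasure Λ FD).restrict A) x ^ ℓ / ℓ.factorial) *
        Real.exp (mgf f ((reportMeasure Λ FD).restrict Aᶜ) x) := by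
  have hm := h.measurable_atomSum hf
  rw [mgf, integral_eq_lintegral_of_nonneg_ae (ae_of_all _ fun u => (Real.exp_pos _).le)
    (Real.measurable_exp.comp (hm.const_mul x)).aestronglyMeasurable,
    h.lintegral_exp_atomSum hA hf hC, ENNReal.toReal_ofReal]
  have := mgf_nonneg (X := f) (μ := (reportMeasure Λ FD).restrict A) (t := x)
  positivity

lemma IsDelayedArrivals.memLp_atomSum (h : IsDelayedArrivals P Λ FD T D)
    (hA : MeasurableSet A) (hf : Measurable f) (hC : ∀ u, |f u| ≤ C) (ℓ : ℕ) (p : NNReal) :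
    MemLp (fun ω => atomSum f (fun k => T k ω) fun k => D k ω) p
      (P.restrict (countEvent T D A ℓ)) := by
  refine memLp_of_mem_interior_integrableExpSet ?_ p
  rw [h.integrableExpSet_atomSum hA hf hC]
  simp

/-- Logarithm of the product formula. Working with the restricted, unnormalised measure only changes
the constant term, which differentiation removes. -/
lemma IsDelayedArrivals.cgf_atomSum (h : IsDelayedArrivals P Λ FD T D)
    (hA : MeasurableSet A) (hf : Measurable f) (hC : ∀ u, |f u| ≤ C) {ℓ : ℕ}
    (hℓ : P (countEvent T D A ℓ) ≠ 0) :
    cgf (fun ω => atomSum f (fun k => T k ω) fun k => D k ω) (P.restrict (countEvent T D A ℓ)) =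
      fun x => ℓ * cgf f ((reportMeasure Λ FD).restrict A) x +
        mgf f ((reportMeasure Λ FD).restrict Aᶜ) x +
        (-(Λ (Icc 0 1)).toReal - Real.log ℓ.factorial) := by
  ext x
  -- Otherwise a positive function would have integral 0 over an event of positive probability. Only
  -- the ℓ-th power is claimed to be nonzero: for ℓ = 0 the set A may be μ-null.
  have hx : mgf f ((reportMeasure Λ FD).restrict A) x ^ ℓ ≠ 0 := by
    intro h0
    have h1 := h.lintegral_exp_atomSum hA hf hC ℓ x
    rw [h0] at h1
    simp only [zero_div, mul_zero, zero_mul, ENNReal.ofReal_zero] at h1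
    have hm := h.measurable_atomSum hf
    rw [lintegral_eq_zero_iff (by fun_prop)] at h1
    refine hℓ ?_
    rw [← Measure.restrict_apply_univ, ← Measure.measure_univ_eq_zero.2 rfl]
    have : (ae (P.restrict (countEvent T D A ℓ))) = ⊥ := by
      rw [← eventually_false_iff_eq_bot]
      filter_upwards [h1] with ω hω
      simp only [Pi.zero_apply, ENNReal.ofReal_eq_zero] at hω
      exact absurd hω (not_le.2 (Real.exp_pos _))
    rw [ae_eq_bot.1 this]
  have hfac : (ℓ.factorial : ℝ) ≠ 0 := by simpa using Nat.factorial_ne_zero ℓ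
  rw [cgf, h.mgf_atomSum hA hf hC, Real.log_mul (by positivity) (Real.exp_pos _).ne',
    Real.log_mul (Real.exp_pos _).ne' (by positivity), Real.log_div hx hfac, Real.log_exp,
    Real.log_exp, Real.log_pow, cgf]
  ring

/-- First derivative of the cumulant generating function at 0. For the finite measure μ restricted
to A this derivative is the integral divided by the mass, so the normalisation on A appears by
itself; the `mgf` term gives the plain integral over Aᶜ. -/
lemma IsDelayedArrivals.integral_atomSum_cond (h : IsDelayedArrivals P Λ FD T D)
    (hA : MeasurableSet A) (hf : Measurable f) (hC : ∀ u, |f u| ≤ C) {ℓ : ℕ}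
    (hℓ : P (countEvent T D A ℓ) ≠ 0) :
    ∫ ω, atomSum f (fun k => T k ω) (fun k => D k ω) ∂(cond P (countEvent T D A ℓ)) =
      ℓ * ((∫ u in A, f u ∂(reportMeasure Λ FD)) / (reportMeasure Λ FD).real A) +
        ∫ u in Aᶜ, f u ∂(reportMeasure Λ FD) := by
  have hint : ∀ B, (0 : ℝ) ∈ interior (integrableExpSet f ((reportMeasure Λ FD).restrict B)) := by
    intro B; rw [integrableExpSet_eq_univ_of_bound hf hC]; simp
  have h1 := deriv_cgf_zero (X := fun ω => atomSum f (fun k => T k ω) fun k => D k ω)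
    (μ := P.restrict (countEvent T D A ℓ)) (by rw [h.integrableExpSet_atomSum hA hf hC]; simp)
  rw [h.cgf_atomSum hA hf hC hℓ, deriv_add_const, deriv_fun_add, deriv_const_mul,
    deriv_cgf_zero (hint _), deriv_mgf_zero (hint _)] at h1
  · rw [ProbabilityTheory.cond, integral_smul_measure, ENNReal.toReal_inv, smul_eq_mul,
      inv_mul_eq_div]
    simpa [measureReal_def] using h1.symm
  · exact (analyticAt_cgf (hint _)).differentiableAt
  · exact ((analyticAt_cgf (hint _)).differentiableAt).const_mul _
  · exact differentiableAt_mgf (hint _)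

lemma IsDelayedArrivals.integral_atomSum_sq_cond (h : IsDelayedArrivals P Λ FD T D)
    (hA : MeasurableSet A) (hf : Measurable f) (hC : ∀ u, |f u| ≤ C) {ℓ : ℕ}
    (hℓ : P (countEvent T D A ℓ) ≠ 0) :
    ∫ ω, atomSum f (fun k => T k ω) (fun k => D k ω) ^ 2 ∂(cond P (countEvent T D A ℓ)) -
        (∫ ω, atomSum f (fun k => T k ω) (fun k => D k ω) ∂(cond P (countEvent T D A ℓ))) ^ 2 =
      ℓ * ((∫ u in A, f u ^ 2 ∂(reportMeasure Λ FD)) / (reportMeasure Λ FD).real A -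
        ((∫ u in A, f u ∂(reportMeasure Λ FD)) / (reportMeasure Λ FD).real A) ^ 2) +
        ∫ u in Aᶜ, f u ^ 2 ∂(reportMeasure Λ FD) := by
  have hint : ∀ B, (0 : ℝ) ∈ interior (integrableExpSet f ((reportMeasure Λ FD).restrict B)) := by
    intro B; rw [integrableExpSet_eq_univ_of_bound hf hC]; simp
  have h0 : (0 : ℝ) ∈ interior (integrableExpSet
      (fun ω => atomSum f (fun k => T k ω) fun k => D k ω) (P.restrict (countEvent T D A ℓ))) := by
    rw [h.integrableExpSet_atomSum hA hf hC]; simp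
  have h1 := iteratedDeriv_two_cgf h0
  rw [deriv_cgf_zero h0, h.cgf_atomSum hA hf hC hℓ] at h1
  have hc : ContDiffAt ℝ 2 (fun x => ℓ * cgf f ((reportMeasure Λ FD).restrict A) x) 0 :=
    contDiffAt_const.mul (analyticAt_cgf (hint _)).contDiffAt
  have hm : ContDiffAt ℝ 2 (fun x => mgf f ((reportMeasure Λ FD).restrict Aᶜ) x) 0 :=
    (analyticAt_mgf (hint _)).contDiffAt
  rw [iteratedDeriv_fun_add (hc.add hm) contDiffAt_const, iteratedDeriv_fun_add hc hm,
    iteratedDeriv_const_mul, iteratedDeriv_two_cgf (hint _), deriv_cgf_zero (hint _),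
    iteratedDeriv_mgf_zero (hint _), iteratedDeriv_const] at h1
  · simp only [ProbabilityTheory.cond, integral_smul_measure, ENNReal.toReal_inv, smul_eq_mul,
      inv_mul_eq_div]
    simpa [measureReal_def] using h1.symm
  · exact (analyticAt_cgf (hint _)).contDiffAt

/-- Campbell's formula, as the case A = ∅, ℓ = 0, where the conditioning event is everything. -/
lemma IsDelayedArrivals.integral_atomSum (h : IsDelayedArrivals P Λ FD T D)
    (hf : Measurable f) (hC : ∀ u, |f u| ≤ C) :
    ∫ ω, atomSum f (fun k => T k ω) (fun k => D k ω) ∂P = ∫ u, f u ∂(reportMeasure Λ FD) := by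
  have huniv : countEvent T D ∅ 0 = univ := eq_univ_of_forall fun ω => by
    change atomSum _ _ _ = 0
    simp [atomSum]
  have h1 := h.integral_atomSum_cond (A := ∅) (ℓ := 0) .empty hf hC (by simp [huniv])
  simpa [huniv] using h1

end ConditionedSums

/-! ### Uniform moment bounds for the cluster process. -/

section MomentBounds

variable {P : Measure Ω} [IsProbabilityMeasure P] {ν : Measure (ℝ × ℝ)} {X : ℝ → Ω → ℝ}

/-- Stochastic continuity makes the process tight on compact time intervals. -/
lemma IsJumpAdditiveProcess.exists_forall_measure_le (hX : IsJumpAdditiveProcess P ν X) (R : ℝ)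
    {ε : ℝ≥0∞} (hε : 0 < ε) : ∃ K : ℝ, ∀ u ∈ Icc 0 R, P {ω | K < |X u ω|} ≤ ε := by
  refine isCompact_Icc.induction_on (p := fun S : Set ℝ =>
    ∃ K : ℝ, ∀ u ∈ S, P {ω | K < |X u ω|} ≤ ε) ⟨0, by simp⟩ ?_ ?_ ?_
  · rintro S S' hSS' ⟨K, hK⟩
    exact ⟨K, fun u hu => hK u (hSS' hu)⟩
  · rintro S S' ⟨K, hK⟩ ⟨K', hK'⟩
    refine ⟨max K K', fun u hu => ?_⟩
    rcases hu with hu | hu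
    · exact (measure_mono fun ω hω => (le_max_left K K').trans_lt hω).trans (hK u hu)
    · exact (measure_mono fun ω hω => (le_max_right K K').trans_lt hω).trans (hK' u hu)
  · intro u hu
    -- Half of ε pays for the tail of X(u), the other half for |X(v) - X(u)| ≥ 1 with v near u.
    have hε2 : 0 < ε / 2 := ENNReal.half_pos hε.ne'
    have h1 : ∃ K : ℕ, P {ω | (K : ℝ) < |X u ω|} < ε / 2 := by
      have hlim := tendsto_measure_iInter_atTop (μ := P) (s := fun K : ℕ => {ω | (K : ℝ) < |X u ω|})
        (fun K => (measurableSet_lt measurable_const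
          (continuous_abs.measurable.comp (hX.measurable u))).nullMeasurableSet)
        (fun a b hab ω (hω : (b : ℝ) < |X u ω|) => lt_of_le_of_lt (Nat.cast_le.2 hab) hω)
        ⟨0, measure_ne_top _ _⟩
      have hempty : ⋂ K : ℕ, {ω | (K : ℝ) < |X u ω|} = ∅ := by
        refine eq_empty_of_forall_notMem fun ω hω => ?_
        obtain ⟨K, hK⟩ := exists_nat_gt |X u ω|
        exact absurd (mem_iInter.1 hω K) (not_lt.2 hK.le)
      rw [hempty, measure_empty] at hlim
      exact (hlim.eventually (gt_mem_nhds hε2)).exists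
    obtain ⟨K, hK⟩ := h1
    have h2 := hX.stoch_continuous u hu.1 1 one_pos
    have h3 := h2.eventually (gt_mem_nhds hε2)
    refine ⟨_, mem_nhdsWithin_of_mem_nhds h3, K + 1, fun v hv => ?_⟩
    have hv' : P {ω | 1 ≤ edist (X v ω) (X u ω)} < ε / 2 := hv
    calc P {ω | (K : ℝ) + 1 < |X v ω|}
        ≤ P ({ω | (K : ℝ) < |X u ω|} ∪ {ω | 1 ≤ edist (X v ω) (X u ω)}) := by
          refine measure_mono fun ω hω => ?_
          by_contra hcon
          simp only [mem_union, mem_ofPred_eq, not_or, not_lt, not_le] at hcon hω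
          have h4 : |X v ω - X u ω| < 1 := by
            have := hcon.2
            rw [edist_dist, ← ENNReal.ofReal_one, ENNReal.ofReal_lt_ofReal_iff one_pos] at this
            rwa [Real.dist_eq] at this
          have := abs_sub_abs_le_abs_sub (X v ω) (X u ω)
          linarith [hcon.1]
      _ ≤ ε / 2 + ε / 2 := (measure_union_le _ _).trans (add_le_add hK.le hv'.le)
      _ = ε := ENNReal.add_halves ε

lemma IsJumpAdditiveProcess.indepFun_sub (hX : IsJumpAdditiveProcess P ν X) {u R : ℝ} (hu : 0 ≤ u)
    (huR : u ≤ R) : IndepFun (X u) (fun ω => X R ω - X u ω) P := by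
  have h := hX.indep_increments 2 ![0, u, R] (by
    intro i j hij
    fin_cases i <;> fin_cases j <;> simp_all [hu.trans huR])
  have h1 := h.indepFun (i := 0) (j := 1) (by simp)
  simp only [Fin.isValue, Fin.succ_zero_eq_one, Matrix.cons_val_one, Matrix.cons_val_zero,
    Fin.castSucc_zero, Fin.succ_one_eq_two, Matrix.cons_val, Fin.castSucc_one] at h1
  refine h1.congr ?_ (ae_of_all _ fun _ => rfl)
  filter_upwards [hX.eq_zero] with ω hω
  simp [hω 0 le_rfl]

/-- On |Z| ≤ K one has |Y| ≤ |Y + Z| + K. This event is independent of Y and has probability at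
least 1/2, so restricting to it loses at most a factor 2. -/
lemma lintegral_rpow_le_of_indepFun {Y Z : Ω → ℝ} (hY : Measurable Y) (hZ : Measurable Z)
    (h : IndepFun Y Z P) {p : ℝ} (hp : 1 ≤ p) {K : ℝ} (hK : P {ω | K < |Z ω|} ≤ 2⁻¹) :
    ∫⁻ ω, ‖Y ω‖ₑ ^ p ∂P ≤
      2 * ((2 : ℝ≥0∞) ^ (p - 1) * (∫⁻ ω, ‖Y ω + Z ω‖ₑ ^ p ∂P + ENNReal.ofReal K ^ p)) := by
  have hS : MeasurableSet {z : ℝ | |z| ≤ K} := measurableSet_le measurable_norm measurable_const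
  have hSP : 2⁻¹ ≤ P {ω | |Z ω| ≤ K} := by
    have h1 : {ω | |Z ω| ≤ K} = {ω | K < |Z ω|}ᶜ := by ext ω; simp
    have h2 : MeasurableSet {ω | K < |Z ω|} :=
      measurableSet_lt measurable_const (continuous_abs.measurable.comp hZ)
    rw [h1, prob_compl_eq_one_sub h2]
    refine ENNReal.le_sub_of_add_le_left (ne_top_of_le_ne_top (by simp) hK) ?_
    calc _ ≤ (2⁻¹ : ℝ≥0∞) + 2⁻¹ := by gcongr
      _ = 1 := ENNReal.inv_two_add_inv_two
  have hmul := lintegral_mul_eq_lintegral_mul_lintegral_of_indepFun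
    (f := fun ω => ‖Y ω‖ₑ ^ p) (g := fun ω => {z : ℝ | |z| ≤ K}.indicator 1 (Z ω))
    (by fun_prop) ((measurable_one.indicator hS).comp hZ)
    (h.comp (φ := fun y => ‖y‖ₑ ^ p) (ψ := {z : ℝ | |z| ≤ K}.indicator (1 : ℝ → ℝ≥0∞))
      (by fun_prop) (measurable_one.indicator hS))
  have hind : ∫⁻ ω, {z : ℝ | |z| ≤ K}.indicator (1 : ℝ → ℝ≥0∞) (Z ω) ∂P = P {ω | |Z ω| ≤ K} := by
    have h1 : MeasurableSet {ω | |Z ω| ≤ K} := hZ hS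
    rw [← lintegral_indicator_one h1]
    rfl
  rw [hind] at hmul
  have hle : (∫⁻ ω, ‖Y ω‖ₑ ^ p ∂P) * 2⁻¹ ≤
      (2 : ℝ≥0∞) ^ (p - 1) * (∫⁻ ω, ‖Y ω + Z ω‖ₑ ^ p ∂P + ENNReal.ofReal K ^ p) := by
    refine (mul_le_mul_right hSP _).trans (hmul.symm.le.trans ?_)
    calc _ ≤ ∫⁻ ω, (2 : ℝ≥0∞) ^ (p - 1) * (‖Y ω + Z ω‖ₑ ^ p + ENNReal.ofReal K ^ p) ∂P := by
          refine lintegral_mono fun ω => ?_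
          simp only [Pi.mul_apply, indicator, mem_ofPred_eq, Pi.one_apply]
          split_ifs with hω
          · rw [mul_one]
            calc ‖Y ω‖ₑ ^ p ≤ (‖Y ω + Z ω‖ₑ + ENNReal.ofReal K) ^ p := by
                  gcongr
                  calc ‖Y ω‖ₑ = ‖Y ω + Z ω - Z ω‖ₑ := by ring_nf
                    _ ≤ ‖Y ω + Z ω‖ₑ + ‖Z ω‖ₑ := enorm_sub_le
                    _ ≤ _ := by
                      gcongr
                      rw [← ofReal_norm]
                      exact ENNReal.ofReal_le_ofReal hω
              _ ≤ _ := ENNReal.rpow_add_le_mul_rpow_add_rpow _ _ hp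
          · simp
      _ = _ := by
          rw [lintegral_const_mul _ (by fun_prop), lintegral_add_right _ measurable_const,
            lintegral_const, measure_univ, mul_one]
  calc ∫⁻ ω, ‖Y ω‖ₑ ^ p ∂P = 2 * ((∫⁻ ω, ‖Y ω‖ₑ ^ p ∂P) * 2⁻¹) := by
        rw [mul_comm, mul_assoc, ENNReal.inv_mul_cancel (by simp) (by simp), mul_one]
    _ ≤ _ := by gcongr

/-- Take Y = X(u) and Z = X(R) - X(u) in the preceding lemma: the moment at time R controls all
earlier ones, with a constant from tightness that does not depend on u. -/
lemma IsJumpAdditiveProcess.exists_forall_eLpNorm_le (hX : IsJumpAdditiveProcess P ν X) {p : ℝ≥0}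
    (hp : 1 ≤ p) (hint : ∀ u, 0 ≤ u → MemLp (X u) p P) (R : ℝ) :
    ∃ C : ℝ≥0, ∀ u ≤ R, eLpNorm (X u) p P ≤ C := by
  -- |X(R) - X(u)| > 2K forces one of the two values above K, so 1/4 + 1/4 gives the required 1/2.
  obtain ⟨K, hK⟩ := hX.exists_forall_measure_le R (ε := 4⁻¹) (by simp)
  have hp0 : (p : ℝ≥0∞) ≠ 0 := by
    simpa using (zero_lt_one.trans_le hp).ne'
  have hp1 : (1 : ℝ) ≤ p := by exact_mod_cast hp
  set C' : ℝ≥0∞ := 2 * ((2 : ℝ≥0∞) ^ ((p : ℝ) - 1) *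
    (∫⁻ ω, ‖X R ω‖ₑ ^ (p : ℝ) ∂P + ENNReal.ofReal (2 * K) ^ (p : ℝ))) with hC'
  by_cases hR : 0 ≤ R
  swap
  · refine ⟨0, fun u hu => ?_⟩
    have : X u =ᵐ[P] 0 := by
      filter_upwards [hX.eq_zero] with ω hω
      exact hω u (hu.trans (not_le.1 hR).le)
    simp [eLpNorm_congr_ae this]
  have hfin : C' ≠ ∞ := by
    refine ENNReal.mul_ne_top (by simp) (ENNReal.mul_ne_top (by simp)
      (ENNReal.add_ne_top.2 ⟨?_, ENNReal.rpow_ne_top_of_nonneg (zero_le_one.trans hp1)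
        ENNReal.ofReal_ne_top⟩))
    have := lintegral_rpow_enorm_lt_top_of_eLpNorm_lt_top hp0 (by simp) (hint R hR).2
    simpa using this.ne
  have hfin' : C' ^ (1 / (p : ℝ)) ≠ ∞ := by simp [hfin]
  refine ⟨(C' ^ (1 / (p : ℝ))).toNNReal, fun u hu => ?_⟩
  rw [ENNReal.coe_toNNReal hfin']
  rcases lt_or_ge u 0 with hneg | hpos
  · have : X u =ᵐ[P] 0 := by
      filter_upwards [hX.eq_zero] with ω hω
      exact hω u hneg.le
    simp [eLpNorm_congr_ae this]
  · rw [eLpNorm_eq_lintegral_rpow_enorm_toReal hp0 (by simp), ENNReal.coe_toReal]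
    gcongr
    have h1 := lintegral_rpow_le_of_indepFun (hX.measurable u)
      ((hX.measurable R).sub (hX.measurable u)) (hX.indepFun_sub hpos hu) hp1 (K := 2 * K) ?_
    · simpa [hC'] using h1
    · calc P {ω | 2 * K < |X R ω - X u ω|} ≤ P ({ω | K < |X R ω|} ∪ {ω | K < |X u ω|}) := by
            refine measure_mono fun ω hω => ?_
            by_contra hcon
            simp only [mem_union, mem_ofPred_eq, not_or, not_lt] at hcon hω
            have := abs_sub (X R ω) (X u ω)
            linarith [hcon.1, hcon.2]
        _ ≤ 4⁻¹ + 4⁻¹ := (measure_union_le _ _).trans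
            (add_le_add (hK R ⟨hR, le_rfl⟩) (hK u ⟨hpos, hu⟩))
        _ = 2⁻¹ := by
          rw [← ENNReal.toReal_eq_toReal_iff' (by simp) (by simp),
            ENNReal.toReal_add (by simp) (by simp)]
          norm_num

end MomentBounds

/-! ### Measurable evaluation of a path at a random time. -/

section PathEvaluation

/-- The value at time `u` of a right continuous path, as a jointly measurable function. -/
noncomputable def pathEval (u : ℝ) (w : ℝ → ℝ) : ℝ :=
  limsup (fun n : ℕ => w ((⌊(2 : ℝ) ^ n * u⌋ + 1 : ℤ) / 2 ^ n)) atTop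

/-- Plain evaluation is not jointly measurable for the product σ-algebra on all paths. On the dyadic
grid only countably many coordinates are used, so each approximant is measurable, and hence the
limsup. -/
lemma measurable_pathEval : Measurable fun z : ℝ × (ℝ → ℝ) => pathEval z.1 z.2 := by
  refine Measurable.limsup fun n => ?_
  have h : Measurable fun y : ℤ × (ℝ → ℝ) => y.2 ((y.1 + 1 : ℤ) / 2 ^ n) :=
    measurable_from_prod_countable_right fun k =>
      measurable_pi_apply (((k + 1 : ℤ) : ℝ) / 2 ^ n)
  exact h.comp ((Int.measurable_floor.comp (measurable_fst.const_mul _)).prodMk measurable_snd)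

lemma measurable_pathEval_comp {f : Ω → ℝ} {g : Ω → ℝ → ℝ} (hf : Measurable f)
    (hg : Measurable g) : Measurable fun ω => pathEval (f ω) (g ω) := by
  have h := measurable_pathEval.comp (hf.prodMk hg)
  simpa only [Function.comp_def] using h

/-- The grid points decrease onto u from the right within 2^{-n}, so right continuity applies for u
≥ 0. For u < 0 they are eventually negative, where the path vanishes. -/
lemma pathEval_eq {w : ℝ → ℝ} (h0 : ∀ u ≤ 0, w u = 0)
    (hw : ∀ u, 0 ≤ u → ContinuousWithinAt w (Ici u) u) (u : ℝ) : pathEval u w = w u := by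
  have hpow : ∀ n : ℕ, (0 : ℝ) < 2 ^ n := fun n => by positivity
  have hle : ∀ n : ℕ, u ≤ ((⌊(2 : ℝ) ^ n * u⌋ + 1 : ℤ) : ℝ) / 2 ^ n := fun n => by
    rw [le_div_iff₀ (hpow n), mul_comm]
    push_cast
    exact (Int.lt_floor_add_one _).le
  have hge : ∀ n : ℕ, ((⌊(2 : ℝ) ^ n * u⌋ + 1 : ℤ) : ℝ) / 2 ^ n ≤ u + (1 / 2) ^ n := fun n => by
    rw [div_le_iff₀ (hpow n), add_mul, ← mul_pow]
    push_cast
    have := Int.floor_le ((2 : ℝ) ^ n * u)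
    norm_num
    linarith [mul_comm u (2 ^ n)]
  have hlim : Tendsto (fun n : ℕ => ((⌊(2 : ℝ) ^ n * u⌋ + 1 : ℤ) : ℝ) / 2 ^ n) atTop (𝓝 u) := by
    refine tendsto_of_tendsto_of_tendsto_of_le_of_le tendsto_const_nhds ?_ hle hge
    simpa using tendsto_const_nhds.add
      (tendsto_pow_atTop_nhds_zero_of_lt_one (r := (1 / 2 : ℝ)) (by norm_num) (by norm_num))
  refine Tendsto.limsup_eq ?_
  rcases lt_or_ge u 0 with hu | hu
  · rw [h0 u hu.le]
    refine tendsto_const_nhds.congr' ?_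
    filter_upwards [hlim.eventually (gt_mem_nhds hu)] with n hn
    exact (h0 _ hn.le).symm
  · exact (hw u hu).tendsto.comp (tendsto_nhdsWithin_iff.2 ⟨hlim, Eventually.of_forall hle⟩)

lemma IsJumpAdditiveProcess.ae_pathEval_eq {P : Measure Ω} {ν : Measure (ℝ × ℝ)} {X : ℝ → Ω → ℝ}
    (hX : IsJumpAdditiveProcess P ν X) : ∀ᵐ ω ∂P, ∀ u, pathEval u (fun r => X r ω) = X u ω := by
  filter_upwards [hX.eq_zero, hX.cadlag] with ω h1 h2
  exact pathEval_eq h1 fun u hu => (h2 u hu).1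

end PathEvaluation

lemma abs_integral_pow_le {P : Measure Ω} {Y : Ω → ℝ} {i : ℕ} (hi : i ≠ 0) {C : ℝ≥0}
    (h : eLpNorm Y ((i : ℝ≥0) : ℝ≥0∞) P ≤ C) : |∫ ω, Y ω ^ i ∂P| ≤ (C : ℝ) ^ i := by
  have h1 := enorm_integral_le_lintegral_enorm (μ := P) fun ω => Y ω ^ i
  have h2 := eLpNorm_nnreal_pow_eq_lintegral (μ := P) (f := Y) (p := (i : ℝ≥0))
    (by simpa using hi)
  simp only [NNReal.coe_natCast, ENNReal.rpow_natCast] at h2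
  simp only [enorm_pow, ← h2] at h1
  have h3 : ‖∫ ω, Y ω ^ i ∂P‖ₑ ≤ ((C ^ i : ℝ≥0) : ℝ≥0∞) := by
    rw [ENNReal.coe_pow]
    exact h1.trans (by gcongr)
  have h4 : ‖∫ ω, Y ω ^ i ∂P‖₊ ≤ C ^ i := by exact_mod_cast h3
  exact_mod_cast h4

/-! ### Moments of cluster increments and convergence of the integrals. -/

section Moments

variable {P : Measure Ω} [IsProbabilityMeasure P] {ν : Measure (ℝ × ℝ)} {X : ℝ → Ω → ℝ}

lemma IsJumpAdditiveProcess.measurable_path (hX : IsJumpAdditiveProcess P ν X) :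
    Measurable fun ω r => X r ω := measurable_pi_lambda _ hX.measurable

lemma IsJumpAdditiveProcess.measurable_moment (hX : IsJumpAdditiveProcess P ν X) (i : ℕ) :
    Measurable (moment P X i) := by
  have h : Measurable fun z : ℝ × Ω => pathEval z.1 (fun r => X r z.2) ^ i :=
    (measurable_pathEval.comp
      (measurable_fst.prodMk (hX.measurable_path.comp measurable_snd))).pow_const i
  have h2 := (h.stronglyMeasurable.integral_prod_right' (ν := P)).measurable
  convert h2 using 1
  ext u
  refine integral_congr_ae ?_
  filter_upwards [hX.ae_pathEval_eq] with ω hω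
  simp only [hω]

lemma IsJumpAdditiveProcess.measurable_incrementMoment (hX : IsJumpAdditiveProcess P ν X) (i : ℕ)
    (t s : ℝ) : Measurable fun u => incrementMoment P X i (t - u) (t + s - u) := by
  have h : Measurable fun z : ℝ × Ω => (pathEval (t + s - z.1) (fun r => X r z.2) -
      pathEval (t - z.1) (fun r => X r z.2)) ^ i :=
    ((measurable_pathEval.comp ((measurable_fst.const_sub (t + s)).prodMk
      (hX.measurable_path.comp measurable_snd))).sub
      (measurable_pathEval.comp ((measurable_fst.const_sub t).prodMk
      (hX.measurable_path.comp measurable_snd)))).pow_const i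
  have h2 := (h.stronglyMeasurable.integral_prod_right' (ν := P)).measurable
  convert h2 using 1
  ext u
  refine integral_congr_ae ?_
  filter_upwards [hX.ae_pathEval_eq] with ω hω
  simp only [hω]

lemma IsJumpAdditiveProcess.exists_forall_abs_moment_le (hX : IsJumpAdditiveProcess P ν X) {i : ℕ}
    (hi : i ≠ 0) (hint : ∀ u, 0 ≤ u → MemLp (X u) ((i : ℝ≥0) : ℝ≥0∞) P) (R : ℝ) :
    ∃ C : ℝ, ∀ u ≤ R, |moment P X i u| ≤ C := by
  obtain ⟨C, hC⟩ := hX.exists_forall_eLpNorm_le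
    (by exact_mod_cast Nat.one_le_iff_ne_zero.2 hi) hint R
  exact ⟨C ^ i, fun u hu => abs_integral_pow_le hi (hC u hu)⟩

lemma IsJumpAdditiveProcess.exists_forall_eLpNorm_sub_le (hX : IsJumpAdditiveProcess P ν X)
    {i : ℕ} (hi : i ≠ 0) (hint : ∀ u, 0 ≤ u → MemLp (X u) ((i : ℝ≥0) : ℝ≥0∞) P) (t : ℝ) {s : ℝ}
    (hs : 0 ≤ s) : ∃ C : ℝ≥0, ∀ u, 0 ≤ u →
      eLpNorm (fun ω => X (t + s - u) ω - X (t - u) ω) ((i : ℝ≥0) : ℝ≥0∞) P ≤ C := by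
  obtain ⟨C, hC⟩ := hX.exists_forall_eLpNorm_le
    (by exact_mod_cast Nat.one_le_iff_ne_zero.2 hi) hint (t + s)
  refine ⟨C + C, fun u hu => ?_⟩
  refine (eLpNorm_sub_le (hX.measurable _).aestronglyMeasurable
    (hX.measurable _).aestronglyMeasurable
    (by exact_mod_cast Nat.one_le_iff_ne_zero.2 hi)).trans ?_
  rw [ENNReal.coe_add]
  exact add_le_add (hC _ (by linarith)) (hC _ (by linarith))

lemma IsJumpAdditiveProcess.exists_forall_abs_incrementMoment_le
    (hX : IsJumpAdditiveProcess P ν X) {i : ℕ} (hi : i ≠ 0)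
    (hint : ∀ u, 0 ≤ u → MemLp (X u) ((i : ℝ≥0) : ℝ≥0∞) P) (t : ℝ) {s : ℝ} (hs : 0 ≤ s) :
    ∃ C : ℝ, ∀ u, 0 ≤ u → |incrementMoment P X i (t - u) (t + s - u)| ≤ C := by
  obtain ⟨C, hC⟩ := hX.exists_forall_eLpNorm_sub_le hi hint t hs
  exact ⟨C ^ i, fun u hu => abs_integral_pow_le hi (hC u hu)⟩

lemma IsJumpAdditiveProcess.indicator_incrementMoment (hX : IsJumpAdditiveProcess P ν X) {i : ℕ}
    (hi : i ≠ 0) (t s : ℝ) :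
    (Iic t)ᶜ.indicator (fun u => incrementMoment P X i (t - u) (t + s - u)) =
      (Ioc t (t + s)).indicator fun u => moment P X i (t + s - u) := by
  ext u
  by_cases h1 : t < u
  swap
  · rw [indicator_of_notMem (by simpa using h1), indicator_of_notMem (fun h => h1 h.1)]
  rw [indicator_of_mem (by simpa using h1)]
  by_cases h2 : u ≤ t + s
  · rw [indicator_of_mem (show u ∈ Ioc t (t + s) from ⟨h1, h2⟩)]
    refine integral_congr_ae ?_
    filter_upwards [hX.eq_zero] with ω hω
    simp [hω (t - u) (by linarith)]
  · rw [indicator_of_notMem (fun h => h2 h.2), incrementMoment]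
    refine integral_eq_zero_of_ae ?_
    filter_upwards [hX.eq_zero] with ω hω
    simp [hω (t - u) (by linarith), hω (t + s - u) (by linarith), hi]

variable {Λ FD : Measure ℝ} [IsLocallyFiniteMeasure Λ] [IsProbabilityMeasure FD]

lemma IsJumpAdditiveProcess.integralsConverge (hX : IsJumpAdditiveProcess P ν X) {i : ℕ}
    (hi : i ≠ 0) (hint : ∀ u, 0 ≤ u → MemLp (X u) ((i : ℝ≥0) : ℝ≥0∞) P) (t : ℝ) {s : ℝ}
    (hs : 0 ≤ s) : IntegralsConverge P Λ FD X t s i := by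
  constructor
  · obtain ⟨C, hC⟩ := hX.exists_forall_abs_incrementMoment_le hi hint t hs
    refine Measure.integrableOn_of_bounded (M := C) (measure_ne_top _ _)
      (hX.measurable_incrementMoment i t s).aestronglyMeasurable ?_
    rw [ae_restrict_iff' measurableSet_Icc]
    exact ae_of_all _ fun u hu => hC u hu.1
  -- The bound up to time s suffices: r > t - v means t + s - v - r < s.
  · obtain ⟨C, hC⟩ := hX.exists_forall_abs_moment_le hi hint s
    have hS : MeasurableSet
        {z : ℝ × ℝ | z.1 ∈ Icc (0 : ℝ) 1 ∧ z.2 ∈ Ioc (t - z.1) (t + s - z.1)} := by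
      refine (measurable_fst measurableSet_Icc).inter (MeasurableSet.inter ?_ ?_)
      · exact measurableSet_lt (measurable_fst.const_sub t) measurable_snd
      · exact measurableSet_le measurable_snd (measurable_fst.const_sub (t + s))
    refine Measure.integrableOn_of_bounded (M := C) ?_
      ((hX.measurable_moment i).comp (by fun_prop)).aestronglyMeasurable ?_
    · refine ne_top_of_le_ne_top ?_
        (measure_mono (t := Icc 0 1 ×ˢ univ) fun z hz => ⟨hz.1, trivial⟩)
      rw [Measure.prod_prod, measure_univ, mul_one]
      exact measure_Icc_ne_top
    · rw [ae_restrict_iff' hS]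
      exact ae_of_all _ fun z hz => hC _ (by linarith [hz.2.1])

/-- For u > t the term L(t - u) vanishes, and L(t + s - u) vanishes once u ≥ t + s, so only (t, t +
s] contributes. Unfolding the convolution with u = v + r gives the double integral. -/
lemma IsJumpAdditiveProcess.setIntegral_compl_Iic (hX : IsJumpAdditiveProcess P ν X) {i : ℕ}
    (hi : i ≠ 0) (hint : ∀ u, 0 ≤ u → MemLp (X u) ((i : ℝ≥0) : ℝ≥0∞) P) (t s : ℝ) :
    ∫ u in (Iic t)ᶜ, incrementMoment P X i (t - u) (t + s - u) ∂(reportMeasure Λ FD) =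
      H P Λ FD X t s i := by
  obtain ⟨C, hC⟩ := hX.exists_forall_abs_moment_le hi hint s
  have : IsFiniteMeasure (Λ.restrict (Icc 0 1)) := ⟨by simpa using measure_Icc_ne_top.lt_top⟩
  have hint' : Integrable ((Ioc t (t + s)).indicator fun u => moment P X i (t + s - u))
      (reportMeasure Λ FD) := by
    rw [integrable_indicator_iff measurableSet_Ioc]
    refine Measure.integrableOn_of_bounded (M := C) (measure_ne_top _ _)
      ((hX.measurable_moment i).comp (by fun_prop)).aestronglyMeasurable ?_
    rw [ae_restrict_iff' measurableSet_Ioc]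
    exact ae_of_all _ fun u hu => hC _ (by linarith [hu.1])
  rw [← integral_indicator measurableSet_Iic.compl, hX.indicator_incrementMoment hi]
  unfold reportMeasure at hint' ⊢
  rw [integral_conv hint', H]
  refine integral_congr_ae (ae_of_all _ fun v => ?_)
  simp only
  rw [← integral_indicator measurableSet_Ioc]
  refine integral_congr_ae (ae_of_all _ fun r => ?_)
  have hiff : v + r ∈ Ioc t (t + s) ↔ r ∈ Ioc (t - v) (t + s - v) := by
    simp only [mem_Ioc]
    constructor <;> rintro ⟨h1, h2⟩ <;> constructor <;> linarith
  simp only [indicator, hiff]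
  congr 2
  ring

end Moments

lemma setIntegral_Iic_indicator_Ici (μ : Measure ℝ) (g : ℝ → ℝ) (t : ℝ) :
    ∫ u in Iic t, (Ici 0).indicator g u ∂μ = ∫ u in Icc 0 t, g u ∂μ := by
  rw [setIntegral_indicator measurableSet_Ici]
  congr 2
  ext u
  simp [and_comm]

lemma setIntegral_compl_Iic_indicator_Ici (μ : Measure ℝ) (g : ℝ → ℝ) {t : ℝ} (ht : 0 ≤ t) :
    ∫ u in (Iic t)ᶜ, (Ici 0).indicator g u ∂μ = ∫ u in (Iic t)ᶜ, g u ∂μ := by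
  refine setIntegral_congr_fun measurableSet_Iic.compl fun u hu => ?_
  have hu' : t < u := by simpa using hu
  exact indicator_of_mem (show u ∈ Ici 0 from ht.trans hu'.le) _

/-! ### Conditioning on one of two independent variables. -/

section ProductLaw

variable {α β : Type*} [MeasurableSpace α] [MeasurableSpace β] {P Q : Measure Ω}
  [IsProbabilityMeasure P] [IsProbabilityMeasure Q] {X : Ω → α} {Y : Ω → β}

/-- Conditioning on an event determined by X restricts only the first factor of the product law: Y
keeps its law under P and stays independent of X. -/
lemma _root_.ProbabilityTheory.IndepFun.map_cond_prod (h : IndepFun X Y P) (hX : Measurable X)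
    (hY : Measurable Y) {S : Set α} (hS : MeasurableSet S) :
    (cond P (X ⁻¹' S)).map (fun ω => (X ω, Y ω)) =
      ((cond P (X ⁻¹' S)).map X).prod (P.map Y) := by
  have := Measure.isProbabilityMeasure_map (μ := P) hY.aemeasurable
  have := Measure.isProbabilityMeasure_map (μ := P) hX.aemeasurable
  have hm := (indepFun_iff_map_prod_eq_prod_map_map hX.aemeasurable hY.aemeasurable).1 h
  have h1 : (P.restrict (X ⁻¹' S)).map (fun ω => (X ω, Y ω)) =
      ((P.restrict (X ⁻¹' S)).map X).prod (P.map Y) := by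
    have hpre : X ⁻¹' S = (fun ω => (X ω, Y ω)) ⁻¹' (S ×ˢ univ) := by ext ω; simp
    rw [← Measure.restrict_map hX hS]
    conv_lhs => rw [hpre, ← Measure.restrict_map (hX.prodMk hY) (hS.prod .univ), hm,
      ← Measure.prod_restrict, Measure.restrict_univ]
  rw [ProbabilityTheory.cond, Measure.map_smul, Measure.map_smul, h1, Measure.prod_smul_left]

lemma lintegral_comp_of_map_eq_prod
    (hQ : Q.map (fun ω => (X ω, Y ω)) = (Q.map X).prod (P.map Y)) (hX : Measurable X)
    (hY : Measurable Y) {g : α × β → ℝ≥0∞} (hg : Measurable g) :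
    ∫⁻ ω, g (X ω, Y ω) ∂Q = ∫⁻ ω, ∫⁻ ω', g (X ω, Y ω') ∂P ∂Q := by
  have := Measure.isProbabilityMeasure_map (μ := P) hY.aemeasurable
  rw [← lintegral_map hg (hX.prodMk hY), hQ, lintegral_prod _ hg.aemeasurable,
    lintegral_map hg.lintegral_prod_right' hX]
  refine lintegral_congr fun ω => ?_
  exact lintegral_map (hg.comp measurable_prodMk_left) hY

lemma integral_comp_of_map_eq_prod
    (hQ : Q.map (fun ω => (X ω, Y ω)) = (Q.map X).prod (P.map Y)) (hX : Measurable X)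
    (hY : Measurable Y) {g : α × β → ℝ} (hg : Measurable g)
    (hint : Integrable (fun ω => g (X ω, Y ω)) Q) :
    ∫ ω, g (X ω, Y ω) ∂Q = ∫ ω, ∫ ω', g (X ω, Y ω') ∂P ∂Q := by
  have := Measure.isProbabilityMeasure_map (μ := P) hY.aemeasurable
  have := Measure.isProbabilityMeasure_map (μ := Q) hX.aemeasurable
  have hint' : Integrable g ((Q.map X).prod (P.map Y)) := by
    rw [← hQ]
    exact (integrable_map_measure hg.aestronglyMeasurable (hX.prodMk hY).aemeasurable).2 hint
  rw [← integral_map (f := g) (hX.prodMk hY).aemeasurable hg.aestronglyMeasurable, hQ,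
    integral_prod _ hint',
    integral_map hX.aemeasurable hg.stronglyMeasurable.integral_prod_right'.aestronglyMeasurable]
  refine integral_congr_ae (ae_of_all _ fun ω => ?_)
  exact integral_map hY.aemeasurable (hg.comp measurable_prodMk_left).aestronglyMeasurable

end ProductLaw

/-- The increment of the total amount in terms of arrivals, delays and cluster paths. -/
noncomputable def clusterSum (t s : ℝ)
    (z : ((ℕ → ℝ≥0∞) × (ℕ → ℝ)) × (ℕ → ℝ → ℝ)) : ℝ :=
  ∑ j ∈ Finset.range (arrivalCount z.1.1),
    (pathEval (t + s - ((z.1.1 j).toReal + z.1.2 j)) (z.2 j) -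
      pathEval (t - ((z.1.1 j).toReal + z.1.2 j)) (z.2 j))

lemma measurable_clusterSum (t s : ℝ) : Measurable (clusterSum t s) := by
  have h : Measurable fun y : ℕ × (((ℕ → ℝ≥0∞) × (ℕ → ℝ)) × (ℕ → ℝ → ℝ)) =>
      ∑ j ∈ Finset.range y.1,
        (pathEval (t + s - ((y.2.1.1 j).toReal + y.2.1.2 j)) (y.2.2 j) -
          pathEval (t - ((y.2.1.1 j).toReal + y.2.1.2 j)) (y.2.2 j)) := by
    refine measurable_from_prod_countable_right fun n => ?_
    refine Finset.measurable_fun_sum (Finset.range n)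
      (f := fun j (z : ((ℕ → ℝ≥0∞) × (ℕ → ℝ)) × (ℕ → ℝ → ℝ)) =>
        pathEval (t + s - ((z.1.1 j).toReal + z.1.2 j)) (z.2 j) -
          pathEval (t - ((z.1.1 j).toReal + z.1.2 j)) (z.2 j)) fun j _ => ?_
    have hτ : Measurable fun z : ((ℕ → ℝ≥0∞) × (ℕ → ℝ)) × (ℕ → ℝ → ℝ) => z.1.1 j := by fun_prop
    have hd : Measurable fun z : ((ℕ → ℝ≥0∞) × (ℕ → ℝ)) × (ℕ → ℝ → ℝ) => z.1.2 j := by fun_prop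
    have h1 := hτ.ennreal_toReal.add hd
    have h2 : Measurable fun z : ((ℕ → ℝ≥0∞) × (ℕ → ℝ)) × (ℕ → ℝ → ℝ) => z.2 j := by fun_prop
    exact (measurable_pathEval_comp (h1.const_sub (t + s)) h2).sub
      (measurable_pathEval_comp (h1.const_sub t) h2)
  have h1 : Measurable fun z : ((ℕ → ℝ≥0∞) × (ℕ → ℝ)) × (ℕ → ℝ → ℝ) => arrivalCount z.1.1 :=
    measurable_arrivalCount.comp (measurable_fst.comp measurable_fst)
  have h2 : Measurable fun z : ((ℕ → ℝ≥0∞) × (ℕ → ℝ)) × (ℕ → ℝ → ℝ) => (arrivalCount z.1.1, z) :=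
    h1.prodMk measurable_id
  have h3 := h.comp h2
  simp only [Function.comp_def] at h3
  exact h3

/-! ### Reduction to cluster sums, and their moments for fixed arrivals and delays. -/

section Reduction

variable {P : Measure Ω} [IsProbabilityMeasure P] {Λ FD : Measure ℝ} [IsLocallyFiniteMeasure Λ]
  [IsProbabilityMeasure FD] {ν : Measure (ℝ × ℝ)} {T : ℕ → Ω → ℝ≥0∞} {D : ℕ → Ω → ℝ}
  {L : ℕ → ℝ → Ω → ℝ}

lemma ae_reported_eq (hT : IsPoissonArrivals P Λ T) (t : ℝ) : ∀ᵐ ω ∂P,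
    reported T D t ω =
      atomSum ((Iic t).indicator (1 : ℝ → ℕ)) (fun k => T k ω) (fun k => D k ω) := by
  classical
  filter_upwards [hT.ae_isRegular] with ω hω
  have hset : {k : ℕ | T k ω ≤ 1 ∧ (T k ω).toReal + D k ω ≤ t} =
      ((Finset.range (arrivalCount fun k => T k ω)).filter fun k => (T k ω).toReal + D k ω ≤ t :
        Finset ℕ) := by
    ext k
    simp [← hω.le_one_iff]
  rw [reported, hset, ncard_coe_finset, atomSum, Finset.card_filter]
  simp [indicator]

lemma IsDelayedArrivals.meanReported_eq (h : IsDelayedArrivals P Λ FD T D) (t : ℝ) :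
    meanReported P T D t = (reportMeasure Λ FD).real (Iic t) := by
  have h1 := h.integral_atomSum (f := (Iic t).indicator 1) (C := 1)
    (measurable_one.indicator measurableSet_Iic) fun u => by
      by_cases hu : u ∈ Iic t <;> simp [indicator, hu]
  rw [integral_indicator_one measurableSet_Iic] at h1
  rw [← h1, meanReported]
  refine integral_congr_ae ?_
  filter_upwards [ae_reported_eq (D := D) h.arrivals t] with ω hω
  rw [hω, atomSum, atomSum, Nat.cast_sum]
  refine Finset.sum_congr rfl fun j _ => ?_
  simp only [indicator]
  split_ifs <;> simp

lemma condReported_eq (hT : IsPoissonArrivals P Λ T) (t : ℝ) (ℓ : ℕ) :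
    condReported P T D t ℓ = cond P (countEvent T D (Iic t) ℓ) := by
  have h : {ω | reported T D t ω = ℓ} =ᵐ[P] countEvent T D (Iic t) ℓ := by
    filter_upwards [ae_reported_eq (D := D) hT t] with ω hω
    refine propext ?_
    change reported T D t ω = ℓ ↔ atomSum _ _ _ = ℓ
    rw [hω]
  rw [condReported, ProbabilityTheory.cond, ProbabilityTheory.cond, measure_congr h,
    Measure.restrict_congr_set h]

lemma ae_increment_eq (hT : IsPoissonArrivals P Λ T)
    (hL : ∀ k, IsJumpAdditiveProcess P ν (L k)) (t s : ℝ) : ∀ᵐ ω ∂P,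
    increment T D L t s ω =
      clusterSum t s ((fun k => T k ω, fun k => D k ω), fun k u => L k u ω) := by
  filter_upwards [hT.ae_isRegular, ae_all_iff.2 fun k => (hL k).ae_pathEval_eq] with ω hω hp
  have htot : ∀ t, totalAmount T D L t ω =
      ∑ j ∈ Finset.range (arrivalCount fun k => T k ω),
        L j (t - ((T j ω).toReal + D j ω)) ω := by
    intro t
    rw [totalAmount, tsum_eq_sum (s := Finset.range (arrivalCount fun k => T k ω))]
    · refine Finset.sum_congr rfl fun j hj => ?_
      rw [if_pos ((hω.le_one_iff j).2 (Finset.mem_range.1 hj))]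
    · intro j hj
      rw [if_neg fun h => hj (Finset.mem_range.2 ((hω.le_one_iff j).1 h))]
  rw [increment, htot, htot, ← Finset.sum_sub_distrib, clusterSum]
  refine Finset.sum_congr rfl fun j _ => ?_
  rw [hp, hp]

/-- The moments of the increments of a cluster which starts at a non-negative time. -/
noncomputable def startMoment (P : Measure Ω) (X : ℝ → Ω → ℝ) (t s : ℝ) (i : ℕ) : ℝ → ℝ :=
  (Ici 0).indicator fun u => incrementMoment P X i (t - u) (t + s - u)

lemma IsJumpAdditiveProcess.measurable_startMoment {X : ℝ → Ω → ℝ}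
    (hX : IsJumpAdditiveProcess P ν X) (t s : ℝ) (i : ℕ) : Measurable (startMoment P X t s i) :=
  (hX.measurable_incrementMoment i t s).indicator measurableSet_Ici

/-- Purpose of the cut at 0 in `startMoment`: the increment moments are bounded for u ≥ 0 but need
not be as u → -∞, while the cumulant argument requires a globally bounded function. Non-negative
delays make the cut harmless. -/
lemma IsJumpAdditiveProcess.exists_forall_abs_startMoment_le {X : ℝ → Ω → ℝ}
    (hX : IsJumpAdditiveProcess P ν X) {i : ℕ} (hi : i ≠ 0)
    (hint : ∀ u, 0 ≤ u → MemLp (X u) ((i : ℝ≥0) : ℝ≥0∞) P) (t : ℝ) {s : ℝ} (hs : 0 ≤ s) :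
    ∃ C : ℝ, ∀ u, |startMoment P X t s i u| ≤ C := by
  obtain ⟨C, hC⟩ := hX.exists_forall_abs_incrementMoment_le hi hint t hs
  refine ⟨C, fun u => ?_⟩
  by_cases hu : 0 ≤ u
  · rw [startMoment, indicator_of_mem (show u ∈ Ici 0 from hu)]
    exact hC u hu
  · rw [startMoment, indicator_of_notMem (show u ∉ Ici 0 from hu), abs_zero]
    exact (abs_nonneg _).trans (hC 0 le_rfl)

/-- The clusters are iid additive processes of jump type. -/
structure IsIIDClusters (P : Measure Ω) (ν : Measure (ℝ × ℝ)) (L : ℕ → ℝ → Ω → ℝ) : Prop where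
  process : ∀ k, IsJumpAdditiveProcess P ν (L k)
  identDistrib :
    ∀ k, IdentDistrib (fun ω (u : ℝ) => L k u ω) (fun ω (u : ℝ) => L 0 u ω) P P
  iIndepFun : iIndepFun (fun k ω (u : ℝ) => L k u ω) P

lemma IsIIDClusters.identDistrib_increment (h : IsIIDClusters P ν L) (k : ℕ) (a b : ℝ) :
    IdentDistrib (fun ω => L k b ω - L k a ω) (fun ω => L 0 b ω - L 0 a ω) P P :=
  (h.identDistrib k).comp (u := fun w : ℝ → ℝ => w b - w a)
    ((measurable_pi_apply b).sub (measurable_pi_apply a))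

lemma IsIIDClusters.memLp_increment (h : IsIIDClusters P ν L) {p : ℝ≥0∞}
    (hint : ∀ u, 0 ≤ u → MemLp (L 0 u) p P) (k : ℕ) (a b : ℝ) :
    MemLp (fun ω => L k b ω - L k a ω) p P := by
  have h1 : ∀ u, MemLp (L 0 u) p P := fun u => by
    rcases le_total 0 u with hu | hu
    · exact hint u hu
    · refine (memLp_congr_ae ?_).2 (MemLp.zero (ε := ℝ))
      filter_upwards [(h.process 0).eq_zero] with ω hω
      exact hω u hu
  exact (h.identDistrib_increment k a b).memLp_iff.2 ((h1 b).sub (h1 a))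

lemma IsIIDClusters.integral_increment_pow (h : IsIIDClusters P ν L) (k i : ℕ) (a b : ℝ) :
    ∫ ω, (L k b ω - L k a ω) ^ i ∂P = incrementMoment P (L 0) i a b :=
  ((h.identDistrib_increment k a b).comp (u := fun x : ℝ => x ^ i) (by fun_prop)).integral_eq

/-- For fixed arrivals and delays the cluster sum is a finite sum of increments. -/
lemma IsIIDClusters.ae_clusterSum_eq (h : IsIIDClusters P ν L) (t s : ℝ) (τ : ℕ → ℝ≥0∞)
    (d : ℕ → ℝ) : (fun ω => clusterSum t s ((τ, d), fun k u => L k u ω)) =ᵐ[P]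
      ∑ j ∈ Finset.range (arrivalCount τ), fun ω =>
        L j (t + s - ((τ j).toReal + d j)) ω - L j (t - ((τ j).toReal + d j)) ω := by
  filter_upwards [ae_all_iff.2 fun k => (h.process k).ae_pathEval_eq] with ω hp
  simp [clusterSum, hp]

lemma startMoment_delayed {X : ℝ → Ω → ℝ} {τ : ℕ → ℝ≥0∞} {d : ℕ → ℝ} (hd : ∀ k, 0 ≤ d k)
    (t s : ℝ) (i j : ℕ) :
    startMoment P X t s i ((τ j).toReal + d j) =
      incrementMoment P X i (t - ((τ j).toReal + d j)) (t + s - ((τ j).toReal + d j)) :=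
  indicator_of_mem (show (τ j).toReal + d j ∈ Ici 0 from
    add_nonneg ENNReal.toReal_nonneg (hd j)) _

lemma IsIIDClusters.integral_clusterSum (h : IsIIDClusters P ν L) (t s : ℝ)
    (hint : ∀ u, 0 ≤ u → MemLp (L 0 u) 1 P) (τ : ℕ → ℝ≥0∞) {d : ℕ → ℝ} (hd : ∀ k, 0 ≤ d k) :
    ∫ ω, clusterSum t s ((τ, d), fun k u => L k u ω) ∂P =
      atomSum (startMoment P (L 0) t s 1) τ d := by
  rw [integral_congr_ae (h.ae_clusterSum_eq t s τ d)]
  simp only [Finset.sum_apply]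
  rw [integral_finsetSum _ fun j _ => (h.memLp_increment hint j _ _).integrable le_rfl, atomSum]
  refine Finset.sum_congr rfl fun j _ => ?_
  rw [startMoment_delayed hd, ← h.integral_increment_pow j]
  simp only [pow_one]

lemma IsIIDClusters.lintegral_clusterSum_le (h : IsIIDClusters P ν L) (t s : ℝ) {C : ℝ≥0}
    (hC : ∀ u, 0 ≤ u →
      eLpNorm (fun ω => L 0 (t + s - u) ω - L 0 (t - u) ω) ((1 : ℕ) : ℝ≥0) P ≤ C)
    (τ : ℕ → ℝ≥0∞) {d : ℕ → ℝ} (hd : ∀ k, 0 ≤ d k) :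
    ∫⁻ ω, ‖clusterSum t s ((τ, d), fun k u => L k u ω)‖ₑ ∂P ≤
      ENNReal.ofReal (atomSum (fun _ => (C : ℝ)) τ d) := by
  rw [← eLpNorm_one_eq_lintegral_enorm, eLpNorm_congr_ae (h.ae_clusterSum_eq t s τ d)]
  refine (eLpNorm_sum_le (fun j _ => ?_) le_rfl).trans ?_
  · exact (((h.process j).measurable _).sub ((h.process j).measurable _)).aestronglyMeasurable
  · rw [atomSum, ENNReal.ofReal_sum_of_nonneg fun _ _ => C.coe_nonneg]
    refine Finset.sum_le_sum fun j _ => ?_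
    rw [ENNReal.ofReal_coe_nnreal, (h.identDistrib_increment j _ _).eLpNorm_eq]
    simpa using hC _ (add_nonneg ENNReal.toReal_nonneg (hd j))

lemma IsIIDClusters.memLp_clusterSum (h : IsIIDClusters P ν L) (t s : ℝ) {p : ℝ≥0∞}
    (hint : ∀ u, 0 ≤ u → MemLp (L 0 u) p P) (τ : ℕ → ℝ≥0∞) (d : ℕ → ℝ) :
    MemLp (fun ω => clusterSum t s ((τ, d), fun k u => L k u ω)) p P :=
  (memLp_congr_ae (h.ae_clusterSum_eq t s τ d)).2
    (memLp_finsetSum' _ fun j _ => h.memLp_increment hint j _ _)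

/-- Second moment as variance plus squared mean; by independence of the clusters the variance is
additive. -/
lemma IsIIDClusters.integral_clusterSum_sq (h : IsIIDClusters P ν L) (t s : ℝ)
    (hint : ∀ u, 0 ≤ u → MemLp (L 0 u) 2 P) (τ : ℕ → ℝ≥0∞) {d : ℕ → ℝ} (hd : ∀ k, 0 ≤ d k) :
    ∫ ω, clusterSum t s ((τ, d), fun k u => L k u ω) ^ 2 ∂P =
      atomSum (fun u => startMoment P (L 0) t s 2 u - startMoment P (L 0) t s 1 u ^ 2) τ d +
        atomSum (startMoment P (L 0) t s 1) τ d ^ 2 := by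
  have hmem := h.memLp_clusterSum t s hint τ d
  have hvar := variance_eq_sub hmem
  rw [variance_congr (h.ae_clusterSum_eq t s τ d), IndepFun.variance_sum] at hvar
  · rw [h.integral_clusterSum t s (fun u hu => (hint u hu).mono_exponent one_le_two) τ hd] at hvar
    simp only [Pi.pow_apply] at hvar
    rw [eq_sub_iff_add_eq] at hvar
    rw [← hvar, atomSum]
    congr 1
    refine Finset.sum_congr rfl fun j _ => ?_
    beta_reduce
    rw [variance_eq_sub (h.memLp_increment hint j _ _), startMoment_delayed hd,
      startMoment_delayed hd, ← h.integral_increment_pow j, ← h.integral_increment_pow j]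
    simp
  · exact fun j _ => h.memLp_increment hint j _ _
  · intro i _ j _ hij
    exact (h.iIndepFun.indepFun hij).comp
      (φ := fun w : ℝ → ℝ =>
        w (t + s - ((τ i).toReal + d i)) - w (t - ((τ i).toReal + d i)))
      (ψ := fun w : ℝ → ℝ =>
        w (t + s - ((τ j).toReal + d j)) - w (t - ((τ j).toReal + d j)))
      ((measurable_pi_apply _).sub (measurable_pi_apply _))
      ((measurable_pi_apply _).sub (measurable_pi_apply _))

end Reduction

/-- Associativity of product measures: the joint law of (Y, X, Z) factors completely and may be
regrouped. -/
lemma _root_.ProbabilityTheory.IndepFun.prodMk_of_indepFun_prodMk {α β γ : Type*}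
    [MeasurableSpace α] [MeasurableSpace β] [MeasurableSpace γ] {P : Measure Ω}
    [IsProbabilityMeasure P] {X : Ω → α} {Y : Ω → β} {Z : Ω → γ} (hX : Measurable X)
    (hY : Measurable Y) (hZ : Measurable Z) (hXZ : IndepFun X Z P)
    (hYXZ : IndepFun Y (fun ω => (X ω, Z ω)) P) : IndepFun (fun ω => (X ω, Y ω)) Z P := by
  have := Measure.isProbabilityMeasure_map (μ := P) hX.aemeasurable
  have := Measure.isProbabilityMeasure_map (μ := P) hY.aemeasurable
  have := Measure.isProbabilityMeasure_map (μ := P) hZ.aemeasurable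
  have hYX : IndepFun Y X P := hYXZ.comp measurable_id measurable_fst
  have h1 := (indepFun_iff_map_prod_eq_prod_map_map hY.aemeasurable
    (hX.prodMk hZ).aemeasurable).1 hYXZ
  have h2 := (indepFun_iff_map_prod_eq_prod_map_map hX.aemeasurable hZ.aemeasurable).1 hXZ
  have h3 := (indepFun_iff_map_prod_eq_prod_map_map hY.aemeasurable hX.aemeasurable).1 hYX
  have h4 : IndepFun (fun ω => (Y ω, X ω)) Z P := by
    rw [indepFun_iff_map_prod_eq_prod_map_map (hY.prodMk hX).aemeasurable hZ.aemeasurable, h3]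
    rw [h2, ← Measure.prodAssoc_prod] at h1
    have h5 := congrArg (fun μ => μ.map MeasurableEquiv.prodAssoc.symm) h1
    simp only [MeasurableEquiv.map_symm_map] at h5
    rw [← h5, Measure.map_map MeasurableEquiv.prodAssoc.symm.measurable (hY.prodMk (hX.prodMk hZ))]
    rfl
  exact h4.comp measurable_swap measurable_id

/-! ### Integrating out the clusters under the conditional law. -/

section Conditional

variable {P : Measure Ω} [IsProbabilityMeasure P] {Λ FD : Measure ℝ} [IsLocallyFiniteMeasure Λ]
  [IsProbabilityMeasure FD] {ν : Measure (ℝ × ℝ)} {T : ℕ → Ω → ℝ≥0∞} {D : ℕ → Ω → ℝ}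
  {L : ℕ → ℝ → Ω → ℝ}

/-- Poisson arrivals with iid non-negative delays and iid clusters, mutually independent. -/
structure IsDelayedClusterModel (P : Measure Ω) (Λ FD : Measure ℝ) (ν : Measure (ℝ × ℝ))
    (T : ℕ → Ω → ℝ≥0∞) (D : ℕ → Ω → ℝ) (L : ℕ → ℝ → Ω → ℝ) : Prop where
  delayed : IsDelayedArrivals P Λ FD T D
  delay_nonneg : ∀ k, ∀ᵐ ω ∂P, 0 ≤ D k ω
  clusters : IsIIDClusters P ν L
  indepFun : IndepFun (fun ω => ((fun k => T k ω), (fun k => D k ω)))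
    (fun ω (k : ℕ) (u : ℝ) => L k u ω) P

variable {A : Set ℝ} {ℓ : ℕ} {t s : ℝ}

lemma IsDelayedArrivals.memLp_atomSum_cond (h : IsDelayedArrivals P Λ FD T D)
    (hA : MeasurableSet A) {f : ℝ → ℝ} (hf : Measurable f) {C : ℝ} (hC : ∀ u, |f u| ≤ C)
    (hℓ : P (countEvent T D A ℓ) ≠ 0) (p : ℝ≥0) :
    MemLp (fun ω => atomSum f (fun k => T k ω) fun k => D k ω) p
      (cond P (countEvent T D A ℓ)) :=
  (h.memLp_atomSum hA hf hC ℓ p).smul_measure (by simpa using hℓ)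

lemma IsDelayedClusterModel.measurable_marks (h : IsDelayedClusterModel P Λ FD ν T D L) :
    Measurable fun ω => ((fun k => T k ω), (fun k => D k ω)) :=
  (measurable_pi_lambda _ h.delayed.arrivals.measurable).prodMk
    (measurable_pi_lambda _ h.delayed.measurable)

lemma IsDelayedClusterModel.measurable_paths (h : IsDelayedClusterModel P Λ FD ν T D L) :
    Measurable fun ω (k : ℕ) (u : ℝ) => L k u ω :=
  measurable_pi_lambda _ fun k => (h.clusters.process k).measurable_path

lemma IsDelayedClusterModel.map_cond_eq_prod (h : IsDelayedClusterModel P Λ FD ν T D L)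
    (hA : MeasurableSet A) (ℓ : ℕ) :
    (cond P (countEvent T D A ℓ)).map (fun ω => (((fun k => T k ω), (fun k => D k ω)),
        fun (k : ℕ) (u : ℝ) => L k u ω)) =
      ((cond P (countEvent T D A ℓ)).map fun ω => ((fun k => T k ω), (fun k => D k ω))).prod
        (P.map fun ω (k : ℕ) (u : ℝ) => L k u ω) := by
  have hS : MeasurableSet {x : (ℕ → ℝ≥0∞) × (ℕ → ℝ) |
      atomSum (A.indicator (1 : ℝ → ℕ)) x.1 x.2 = ℓ} :=
    measurable_atomSum (measurable_one.indicator hA) (measurableSet_singleton ℓ)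
  exact h.indepFun.map_cond_prod h.measurable_marks h.measurable_paths hS

lemma IsDelayedClusterModel.ae_cond_delay_nonneg (h : IsDelayedClusterModel P Λ FD ν T D L)
    (A : Set ℝ) (ℓ : ℕ) : ∀ᵐ ω ∂(cond P (countEvent T D A ℓ)), ∀ k, 0 ≤ D k ω :=
  cond_absolutelyContinuous.ae_le (ae_all_iff.2 h.delay_nonneg)

/-- By Tonelli, the mean of |M(t, t+s]| over the clusters is at most C times the number of arrivals,
which is itself an `atomSum` of a bounded function and so has all conditional moments. -/
lemma IsDelayedClusterModel.integrable_clusterSum (h : IsDelayedClusterModel P Λ FD ν T D L)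
    (hA : MeasurableSet A) (hℓ : P (countEvent T D A ℓ) ≠ 0) (hs : 0 ≤ s)
    (hint : ∀ u, 0 ≤ u → MemLp (L 0 u) 1 P) :
    Integrable (fun ω => clusterSum t s (((fun k => T k ω), (fun k => D k ω)),
      fun k u => L k u ω)) (cond P (countEvent T D A ℓ)) := by
  have := cond_isProbabilityMeasure hℓ
  obtain ⟨C, hC⟩ := (h.clusters.process 0).exists_forall_eLpNorm_sub_le one_ne_zero
    (by simpa using hint) t hs
  have hm := (measurable_clusterSum t s)
  refine ⟨(hm.comp (h.measurable_marks.prodMk h.measurable_paths)).aestronglyMeasurable, ?_⟩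
  rw [HasFiniteIntegral, lintegral_comp_of_map_eq_prod (h.map_cond_eq_prod hA ℓ)
    h.measurable_marks h.measurable_paths (g := fun z => ‖clusterSum t s z‖ₑ) hm.enorm]
  have hle : ∀ᵐ ω ∂(cond P (countEvent T D A ℓ)),
      ∫⁻ ω', ‖clusterSum t s (((fun k => T k ω), (fun k => D k ω)), fun k u => L k u ω')‖ₑ ∂P ≤
        ENNReal.ofReal (atomSum (fun _ => (C : ℝ)) (fun k => T k ω) fun k => D k ω) := by
    filter_upwards [h.ae_cond_delay_nonneg A ℓ] with ω hω
    exact h.clusters.lintegral_clusterSum_le t s hC _ hω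
  refine (lintegral_mono_ae hle).trans_lt ?_
  have hi : Integrable (fun ω => atomSum (fun _ => (C : ℝ)) (fun k => T k ω) fun k => D k ω)
      (cond P (countEvent T D A ℓ)) :=
    memLp_one_iff_integrable.1 (by
      simpa using h.delayed.memLp_atomSum_cond hA (f := fun _ => (C : ℝ)) measurable_const
        (C := C) (fun u => by simp) hℓ 1)
  refine lt_of_le_of_lt (lintegral_mono fun ω => ?_) hi.2
  exact Real.ofReal_le_enorm _

lemma IsDelayedClusterModel.integral_clusterSum (h : IsDelayedClusterModel P Λ FD ν T D L)
    (hA : MeasurableSet A) (hℓ : P (countEvent T D A ℓ) ≠ 0) (hs : 0 ≤ s)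
    (hint : ∀ u, 0 ≤ u → MemLp (L 0 u) 1 P) :
    ∫ ω, clusterSum t s (((fun k => T k ω), (fun k => D k ω)), fun k u => L k u ω)
        ∂(cond P (countEvent T D A ℓ)) =
      ∫ ω, atomSum (startMoment P (L 0) t s 1) (fun k => T k ω) (fun k => D k ω)
        ∂(cond P (countEvent T D A ℓ)) := by
  have := cond_isProbabilityMeasure hℓ
  rw [integral_comp_of_map_eq_prod (h.map_cond_eq_prod hA ℓ) h.measurable_marks
    h.measurable_paths (measurable_clusterSum t s) (h.integrable_clusterSum hA hℓ hs hint)]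
  refine integral_congr_ae ?_
  filter_upwards [h.ae_cond_delay_nonneg A ℓ] with ω hω
  exact h.clusters.integral_clusterSum t s hint _ hω

/-- The conditional variance of a cluster which starts at a non-negative time. -/
noncomputable def startVariance (P : Measure Ω) (X : ℝ → Ω → ℝ) (t s : ℝ) (u : ℝ) : ℝ :=
  startMoment P X t s 2 u - startMoment P X t s 1 u ^ 2

lemma IsJumpAdditiveProcess.measurable_startVariance {X : ℝ → Ω → ℝ}
    (hX : IsJumpAdditiveProcess P ν X) (t s : ℝ) : Measurable (startVariance P X t s) :=
  (hX.measurable_startMoment t s 2).sub ((hX.measurable_startMoment t s 1).pow_const 2)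

lemma IsDelayedClusterModel.exists_forall_abs_startVariance_le
    (h : IsDelayedClusterModel P Λ FD ν T D L) (hs : 0 ≤ s)
    (hint : ∀ u, 0 ≤ u → MemLp (L 0 u) 2 P) (t : ℝ) :
    ∃ C, ∀ u, |startVariance P (L 0) t s u| ≤ C := by
  obtain ⟨C₁, hC₁⟩ := (h.clusters.process 0).exists_forall_abs_startMoment_le one_ne_zero
    (fun u hu => by simpa using (hint u hu).mono_exponent one_le_two) t hs
  obtain ⟨C₂, hC₂⟩ := (h.clusters.process 0).exists_forall_abs_startMoment_le two_ne_zero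
    (by simpa using hint) t hs
  refine ⟨C₂ + C₁ ^ 2, fun u => (abs_sub _ _).trans (add_le_add (hC₂ u) ?_)⟩
  rw [abs_pow]
  exact pow_le_pow_left₀ (abs_nonneg _) (hC₁ u) 2

/-- Law of total variance in second-moment form. Square integrability comes first, by Tonelli, since
the inner second moment is a combination of sums of bounded functions. -/
lemma IsDelayedClusterModel.integral_clusterSum_sq (h : IsDelayedClusterModel P Λ FD ν T D L)
    (hA : MeasurableSet A) (hℓ : P (countEvent T D A ℓ) ≠ 0) (hs : 0 ≤ s)
    (hint : ∀ u, 0 ≤ u → MemLp (L 0 u) 2 P) :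
    MemLp (fun ω => clusterSum t s (((fun k => T k ω), (fun k => D k ω)), fun k u => L k u ω)) 2
        (cond P (countEvent T D A ℓ)) ∧
      ∫ ω, clusterSum t s (((fun k => T k ω), (fun k => D k ω)), fun k u => L k u ω) ^ 2
        ∂(cond P (countEvent T D A ℓ)) =
      ∫ ω, atomSum (startVariance P (L 0) t s) (fun k => T k ω) (fun k => D k ω)
          ∂(cond P (countEvent T D A ℓ)) +
        ∫ ω, atomSum (startMoment P (L 0) t s 1) (fun k => T k ω) (fun k => D k ω) ^ 2
          ∂(cond P (countEvent T D A ℓ)) := by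
  have := cond_isProbabilityMeasure hℓ
  have hX := h.clusters.process 0
  have hint1 : ∀ u, 0 ≤ u → MemLp (L 0 u) 1 P := fun u hu => (hint u hu).mono_exponent one_le_two
  obtain ⟨C₁, hC₁⟩ := hX.exists_forall_abs_startMoment_le one_ne_zero (by simpa using hint1) t hs
  obtain ⟨C₂, hC₂⟩ := h.exists_forall_abs_startVariance_le hs hint t
  have hm := measurable_clusterSum t s
  have hm2 : Measurable fun z => clusterSum t s z ^ 2 := hm.pow_const 2
  have hmω : Measurable fun ω => clusterSum t s
      (((fun k => T k ω), (fun k => D k ω)), fun k u => L k u ω) :=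
    hm.comp (h.measurable_marks.prodMk h.measurable_paths)
  have hV : Integrable (fun ω => atomSum (startVariance P (L 0) t s) (fun k => T k ω)
      fun k => D k ω) (cond P (countEvent T D A ℓ)) :=
    memLp_one_iff_integrable.1 (by
      simpa using h.delayed.memLp_atomSum_cond hA (hX.measurable_startVariance t s) hC₂ hℓ 1)
  have hF : Integrable (fun ω => atomSum (startMoment P (L 0) t s 1) (fun k => T k ω)
      (fun k => D k ω) ^ 2) (cond P (countEvent T D A ℓ)) :=
    MemLp.integrable_sq (by
      simpa using h.delayed.memLp_atomSum_cond hA (hX.measurable_startMoment t s 1) hC₁ hℓ 2)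
  have heq : ∀ᵐ ω ∂(cond P (countEvent T D A ℓ)),
      ∫ ω', clusterSum t s (((fun k => T k ω), (fun k => D k ω)), fun k u => L k u ω') ^ 2 ∂P =
        atomSum (startVariance P (L 0) t s) (fun k => T k ω) (fun k => D k ω) +
        atomSum (startMoment P (L 0) t s 1) (fun k => T k ω) (fun k => D k ω) ^ 2 := by
    filter_upwards [h.ae_cond_delay_nonneg A ℓ] with ω hω
    exact h.clusters.integral_clusterSum_sq t s hint _ hω
  have hsq : Integrable (fun ω => clusterSum t s
      (((fun k => T k ω), (fun k => D k ω)), fun k u => L k u ω) ^ 2)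
      (cond P (countEvent T D A ℓ)) := by
    refine ⟨(hmω.pow_const 2).aestronglyMeasurable, ?_⟩
    rw [HasFiniteIntegral, lintegral_comp_of_map_eq_prod (h.map_cond_eq_prod hA ℓ)
      h.measurable_marks h.measurable_paths (g := fun z => ‖clusterSum t s z ^ 2‖ₑ) hm2.enorm]
    refine lt_of_le_of_lt (lintegral_mono_ae ?_) (hV.add hF).2
    filter_upwards [heq] with ω hω
    simp only [Pi.add_apply]
    rw [← hω]
    refine le_trans (le_of_eq ?_) (Real.ofReal_le_enorm _)
    rw [ofReal_integral_eq_lintegral_ofReal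
      (h.clusters.memLp_clusterSum t s hint _ _).integrable_sq (ae_of_all _ fun _ => sq_nonneg _)]
    exact lintegral_congr fun ω' => Real.enorm_of_nonneg (sq_nonneg _)
  refine ⟨(memLp_two_iff_integrable_sq hmω.aestronglyMeasurable).2 hsq, ?_⟩
  rw [integral_comp_of_map_eq_prod (h.map_cond_eq_prod hA ℓ) h.measurable_marks
    h.measurable_paths hm2 hsq, ← integral_add hV hF]
  exact integral_congr_ae heq

end Conditional

/-! ### Identification with J and H. -/

section Moments

variable {P : Measure Ω} [IsProbabilityMeasure P]
  {Λ FD : Measure ℝ} [IsLocallyFiniteMeasure Λ] [IsProbabilityMeasure FD] {ν : Measure (ℝ × ℝ)}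
  {T : ℕ → Ω → ℝ≥0∞} {D : ℕ → Ω → ℝ} {L : ℕ → ℝ → Ω → ℝ} {t s : ℝ} {ℓ : ℕ}

lemma IsDelayedClusterModel.integral_startMoment_Iic_div (h : IsDelayedClusterModel P Λ FD ν T D L)
    (t s : ℝ) (i : ℕ) :
    (∫ u in Iic t, startMoment P (L 0) t s i u ∂(reportMeasure Λ FD)) /
      (reportMeasure Λ FD).real (Iic t) = J P Λ FD (meanReported P T D t) (L 0) t s i := by
  rw [J, h.delayed.meanReported_eq, startMoment, setIntegral_Iic_indicator_Ici]

lemma IsDelayedClusterModel.integral_startMoment_compl_Iic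
    (h : IsDelayedClusterModel P Λ FD ν T D L) {i : ℕ} (hi : i ≠ 0)
    (hint : ∀ u, 0 ≤ u → MemLp (L 0 u) ((i : ℝ≥0) : ℝ≥0∞) P) (ht : 0 ≤ t) (s : ℝ) :
    ∫ u in (Iic t)ᶜ, startMoment P (L 0) t s i u ∂(reportMeasure Λ FD) =
      H P Λ FD (L 0) t s i := by
  rw [startMoment, setIntegral_compl_Iic_indicator_Ici _ _ ht,
    (h.clusters.process 0).setIntegral_compl_Iic hi hint]

lemma IsDelayedClusterModel.integral_clusterSum_eq (h : IsDelayedClusterModel P Λ FD ν T D L)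
    (ht : 0 ≤ t) (hs : 0 ≤ s) (hℓ : P (countEvent T D (Iic t) ℓ) ≠ 0)
    (hint : ∀ u, 0 ≤ u → MemLp (L 0 u) 1 P) :
    ∫ ω, clusterSum t s (((fun k => T k ω), (fun k => D k ω)), fun k u => L k u ω)
        ∂(cond P (countEvent T D (Iic t) ℓ)) =
      ℓ * J P Λ FD (meanReported P T D t) (L 0) t s 1 + H P Λ FD (L 0) t s 1 := by
  have hint' : ∀ u, 0 ≤ u → MemLp (L 0 u) (((1 : ℕ) : ℝ≥0) : ℝ≥0∞) P := by simpa using hint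
  obtain ⟨C, hC⟩ :=
    (h.clusters.process 0).exists_forall_abs_startMoment_le one_ne_zero hint' t hs
  rw [h.integral_clusterSum measurableSet_Iic hℓ hs hint,
    h.delayed.integral_atomSum_cond measurableSet_Iic
      ((h.clusters.process 0).measurable_startMoment t s 1) hC hℓ,
    h.integral_startMoment_Iic_div, h.integral_startMoment_compl_Iic one_ne_zero hint' ht]

lemma IsDelayedClusterModel.variance_clusterSum_eq (h : IsDelayedClusterModel P Λ FD ν T D L)
    (ht : 0 ≤ t) (hs : 0 ≤ s) (hℓ : P (countEvent T D (Iic t) ℓ) ≠ 0)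
    (hint : ∀ u, 0 ≤ u → MemLp (L 0 u) 2 P) :
    variance (fun ω => clusterSum t s
        (((fun k => T k ω), (fun k => D k ω)), fun k u => L k u ω))
        (cond P (countEvent T D (Iic t) ℓ)) =
      ℓ * J P Λ FD (meanReported P T D t) (L 0) t s 2
        - ℓ * J P Λ FD (meanReported P T D t) (L 0) t s 1 ^ 2 + H P Λ FD (L 0) t s 2 := by
  have := cond_isProbabilityMeasure hℓ
  have hX := h.clusters.process 0
  have hint1 : ∀ u, 0 ≤ u → MemLp (L 0 u) 1 P := fun u hu => (hint u hu).mono_exponent one_le_two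
  have hint2' : ∀ u, 0 ≤ u → MemLp (L 0 u) (((2 : ℕ) : ℝ≥0) : ℝ≥0∞) P := by simpa using hint
  obtain ⟨C₁, hC₁⟩ := hX.exists_forall_abs_startMoment_le one_ne_zero (by simpa using hint1) t hs
  obtain ⟨C₂, hC₂⟩ := hX.exists_forall_abs_startMoment_le two_ne_zero hint2' t hs
  obtain ⟨C₃, hC₃⟩ := h.exists_forall_abs_startVariance_le hs hint t
  obtain ⟨hmem, hsq⟩ := h.integral_clusterSum_sq (t := t) measurableSet_Iic hℓ hs hint
  have hm := hX.measurable_startMoment t s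
  have hsub : ∀ B : Set ℝ, ∫ u in B, startVariance P (L 0) t s u ∂(reportMeasure Λ FD) =
      ∫ u in B, startMoment P (L 0) t s 2 u ∂(reportMeasure Λ FD) -
        ∫ u in B, startMoment P (L 0) t s 1 u ^ 2 ∂(reportMeasure Λ FD) := by
    intro B
    refine integral_sub (Integrable.of_bound (hm 2).aestronglyMeasurable C₂
      (ae_of_all _ hC₂)) (Integrable.of_bound ((hm 1).pow_const 2).aestronglyMeasurable (C₁ ^ 2)
      (ae_of_all _ fun u => ?_))
    rw [norm_pow]
    exact pow_le_pow_left₀ (abs_nonneg _) (hC₁ u) 2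
  have hF := h.delayed.integral_atomSum_sq_cond measurableSet_Iic (hm 1) hC₁ hℓ
  have hV := h.delayed.integral_atomSum_cond measurableSet_Iic
    (hX.measurable_startVariance t s) hC₃ hℓ
  rw [variance_eq_sub hmem]
  simp only [Pi.pow_apply]
  -- The integrals of m_1² enter with a minus sign through the mean of ∑ (m_2 - m_1²)(S_j) and with
  -- a plus sign through the variance of ∑ m_1(S_j). They cancel both on A and on Aᶜ.
  rw [hsq, h.integral_clusterSum measurableSet_Iic hℓ hs hint1, add_sub_assoc, hF, hV, hsub, hsub,
    sub_div, h.integral_startMoment_Iic_div, h.integral_startMoment_Iic_div,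
    h.integral_startMoment_compl_Iic two_ne_zero hint2' ht]
  ring

end Moments

end DelayedCluster

theorem theorem3p2 {Ω : Type*} [MeasurableSpace Ω] (P : Measure Ω) [IsProbabilityMeasure P]
    (Λ FD : Measure ℝ) [IsLocallyFiniteMeasure Λ] [IsProbabilityMeasure FD]
    (ν : Measure (ℝ × ℝ)) (hν : DelayedCluster.IsJumpIntensity ν)
    (T : ℕ → Ω → ℝ≥0∞) (D : ℕ → Ω → ℝ) (L : ℕ → ℝ → Ω → ℝ)
    -- the arrivals form a Poisson process with mean measure `Λ`
    (hT : DelayedCluster.IsPoissonArrivals P Λ T)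
    -- the delays are iid with law `FD`
    (hDmeas : ∀ k, Measurable (D k)) (hDnonneg : ∀ k, ∀ᵐ ω ∂P, 0 ≤ D k ω)
    (hDlaw : ∀ k, P.map (D k) = FD) (hDindep : iIndepFun D P)
    -- the clusters are iid additive processes of jump type
    (hL : ∀ k, DelayedCluster.IsJumpAdditiveProcess P ν (L k))
    (hLident : ∀ k, IdentDistrib (fun ω (u : ℝ) => L k u ω) (fun ω (u : ℝ) => L 0 u ω) P P)
    (hLindep : iIndepFun (fun k ω (u : ℝ) => L k u ω) P)
    -- arrivals, delays and clusters are mutually independent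
    (hTL : IndepFun (fun ω (k : ℕ) => T k ω) (fun ω (k : ℕ) (u : ℝ) => L k u ω) P)
    (hDTL : IndepFun (fun ω (k : ℕ) => D k ω)
      (fun ω => ((fun k : ℕ => T k ω), (fun (k : ℕ) (u : ℝ) => L k u ω))) P)
    (t s : ℝ) (ht : 1 ≤ t) (hs : 0 < s) (ℓ : ℕ)
    (hℓ : P {ω | DelayedCluster.reported T D t ω = ℓ} ≠ 0) :
    -- (i) the conditional mean
    ((∀ u, 0 ≤ u → Integrable (L 0 u) P) →
      DelayedCluster.IntegralsConverge P Λ FD (L 0) t s 1 ∧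
      Integrable (DelayedCluster.increment T D L t s) (DelayedCluster.condReported P T D t ℓ) ∧
      ∫ ω, DelayedCluster.increment T D L t s ω ∂(DelayedCluster.condReported P T D t ℓ) =
        ℓ * DelayedCluster.J P Λ FD (DelayedCluster.meanReported P T D t) (L 0) t s 1
          + DelayedCluster.H P Λ FD (L 0) t s 1) ∧
    -- (ii) the conditional variance
    ((∀ u, 0 ≤ u → MemLp (L 0 u) 2 P) →
      DelayedCluster.IntegralsConverge P Λ FD (L 0) t s 2 ∧
      MemLp (DelayedCluster.increment T D L t s) 2 (DelayedCluster.condReported P T D t ℓ) ∧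
      variance (DelayedCluster.increment T D L t s) (DelayedCluster.condReported P T D t ℓ) =
        ℓ * DelayedCluster.J P Λ FD (DelayedCluster.meanReported P T D t) (L 0) t s 2
          - ℓ * DelayedCluster.J P Λ FD (DelayedCluster.meanReported P T D t) (L 0) t s 1 ^ 2
          + DelayedCluster.H P Λ FD (L 0) t s 2) := by
  have hDT : IndepFun (fun ω => fun k : ℕ => D k ω) (fun ω => fun k : ℕ => T k ω) P :=
    hDTL.comp measurable_id measurable_fst
  have h : DelayedCluster.IsDelayedClusterModel P Λ FD ν T D L :=
    { delayed := ⟨hT, hDmeas, hDlaw, hDindep, hDT.symm⟩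
      delay_nonneg := hDnonneg
      clusters := ⟨hL, hLident, hLindep⟩
      indepFun := hTL.prodMk_of_indepFun_prodMk (measurable_pi_lambda _ hT.measurable)
        (measurable_pi_lambda _ hDmeas)
        (measurable_pi_lambda _ fun k => (hL k).measurable_path) hDTL }
  have hℓ' : P (DelayedCluster.countEvent T D (Iic t) ℓ) ≠ 0 := by
    intro h0
    -- Both events give the same conditional measure. It would be 0 if the second event were null,
    -- but it is a probability measure by `hℓ`.
    have hQ := DelayedCluster.condReported_eq (D := D) hT t ℓ
    rw [ProbabilityTheory.cond_eq_zero_of_meas_eq_zero h0, DelayedCluster.condReported] at hQ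
    have := cond_isProbabilityMeasure hℓ
    exact IsProbabilityMeasure.ne_zero _ hQ
  have hae : DelayedCluster.increment T D L t s =ᵐ[DelayedCluster.condReported P T D t ℓ]
      fun ω => DelayedCluster.clusterSum t s
        (((fun k => T k ω), (fun k => D k ω)), fun k u => L k u ω) :=
    cond_absolutelyContinuous.ae_le (DelayedCluster.ae_increment_eq hT hL t s)
  have ht0 : 0 ≤ t := zero_le_one.trans ht
  rw [DelayedCluster.condReported_eq hT] at hae ⊢
  refine ⟨fun hint => ?_, fun hint => ?_⟩
  · have hint' : ∀ u, 0 ≤ u → MemLp (L 0 u) 1 P := fun u hu =>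
      memLp_one_iff_integrable.2 (hint u hu)
    refine ⟨(hL 0).integralsConverge one_ne_zero (by simpa using hint') t hs.le, ?_, ?_⟩
    · exact (integrable_congr hae).2
        (h.integrable_clusterSum measurableSet_Iic hℓ' hs.le hint')
    · rw [integral_congr_ae hae]
      exact h.integral_clusterSum_eq ht0 hs.le hℓ' hint'
  · refine ⟨(hL 0).integralsConverge two_ne_zero (by simpa using hint) t hs.le, ?_, ?_⟩
    · exact (memLp_congr_ae hae).2 (h.integral_clusterSum_sq measurableSet_Iic hℓ' hs.le hint).1
    · rw [variance_congr hae]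
      exact h.variance_clusterSum_eq ht0 hs.le hℓ' hint
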